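/- Let $k$ be an algebraically closed field containing $\mathbb{R}$, $F=k((z))$, $\mathfrak{o}=k[[z]]$, $\tau=z\frac{d}{dz}$, and let $(U,\nabla)$ be a formal flat vector bundle: a finite-dimensional $F$-vector space $U$ with a connection $\nabla:U\to\Omega^1(U)=U\frac{dz}{z}$, that is, $\nabla u=\nabla_\tau(u)\frac{dz}{z}$ with $\nabla_\tau:U\to U$ $k$-linear and $\nabla_\tau(fu)=\tau(f)u+f\nabla_\tau(u)$ for $f\in F$, $u\in U$. *Regular singularity and slope.* $(U,\nabla)$ is regular singular if $\nabla_\tau(L)\subseteq L$ for some $\mathfrak{o}$-lattice $L\subset U$; its slope is then $0$. Otherwise it is irregular singular, and its slope is the positive rational number $t$ such that $\{v(\nabla_\tau^i\mathbf{e})+ti\mid i>0\}$ is bounded, where $\mathbf{e}$ is a basis of $U$, $L$ is an $\mathfrak o$-lattice in $U$, $\nabla_\tau^i\mathbf e=\{\nabla_\tau^i e_j\}_j$, and $v(\mathbf{e}')$ is the greatest integer $m$ with $\mathbf{e}'\subset z^mL$. *Points of the building.* A point $x$ of the (enlarged) Bruhat--Tits building of $\mathrm{GL}(U)$ is identified with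 its periodic filtration $\{U_{x,r}\}_{r\in\mathbb{R}}$ of $U$ by $\mathfrak{o}$-lattices. These are the filtrations for which there are a basis $b_1,\dots,b_n$ of $U$ and real numbers $a_1,\dots,a_n$ such that $U_{x,r}$ is, for every $r$, the set of vectors $\sum_i f_ib_i$ in which $f_i\in F$ only involves powers $z^m$ with $a_i+m\ge r$. Put $\mathfrak{gl}(U)=\mathrm{End}_F(U)$, $\mathfrak{gl}(U)_{x,r}=\{Y\mid Y(U_{x,s})\subseteq U_{x,s+r}\ \forall s\in\mathbb{R}\}$, $U_{x,r+}=\bigcup_{s>r}U_{x,s}$ and $\mathfrak{gl}(U)_{x,r+}=\bigcup_{s>r}\mathfrak{gl}(U)_{x,s}$. *Strata.* A $U$-stratum of depth $r$ is a triple $(x,r,\beta)$ with $x$ a point of the building, $r\ge0$ a real number, and $\beta$ a $k$-linear functional on $\mathfrak{gl}(U)_{x,r}/\mathfrak{gl}(U)_{x,r+}$. An element $Y\in\mathfrak{gl}(U)_{x,-r}$ represents $\beta$ if $\beta$ is induced by $Z\mapsto\mathrm{Res}\,\mathrm{Tr}(YZ)\frac{dz}{z}$. The stratum is fundamental if every representative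 of $\beta$ is non-nilpotent. It is contained in $(U,\nabla)$ if for some (equivalently, any) representative $Y$ of $\beta$, $$(\nabla_\tau-j-Y)(U_{x,j})\subseteq U_{x,(j-r)+}\qquad\text{for all }j\in\mathbb{R}.$$ **Proposition.** The slope of $(U,\nabla)$ is well defined: exactly one rational number is the slope, and it does not depend on the choice of $L$ and $\mathbf{e}$. Moreover: 1. the slope of $(U,\nabla)$ is the minimum of the depths of the strata contained in $(U,\nabla)$; 2. if a stratum $(x,r,\beta)$ contained in $(U,\nabla)$ is fundamental, then $r$ is equal to the slope of $(U,\nabla)$; 3. conversely, if a stratum $(x,r,\beta)$ contained in $(U,\nabla)$ has $r>0$ and $r$ is equal to the slope of $(U,\nabla)$, then $(x,r,\beta)$ is fundamental; 4. in particular, $(U,\nabla)$ is regular singular if and only if it contains a stratum of depth $0$. -/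

import Mathlib

open LaurentSeries PowerSeries

universe u v

noncomputable section

namespace FormalConnection

/-- The Euler vector field `τ = z d/dz` acting on the field `F = k((z))`. -/
def euler {k : Type u} [Field k] (f : k⸨X⸩) : k⸨X⸩ :=
  HahnSeries.single (1 : ℤ) (1 : k) * LaurentSeries.derivative k f

theorem euler_coeff {k : Type u} [Field k] (f : k⸨X⸩) (n : ℤ) :
    (euler f).coeff n = (n : k) * f.coeff n := by
  have h := HahnSeries.coeff_single_mul_add (r := (1 : k))
    (x := LaurentSeries.derivative k f) (a := n - 1) (b := (1 : ℤ))
  rw [sub_add_cancel] at h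
  rw [euler, h, LaurentSeries.derivative_apply, LaurentSeries.hasseDeriv_coeff]
  simp

section Definitions

variable (k : Type u) [Field k]
variable (U : Type v) [AddCommGroup U] [Module k⸨X⸩ U] [Module k⟦X⟧ U] [IsScalarTower k⟦X⟧ k⸨X⸩ U]
  [Module k U] [IsScalarTower k k⸨X⸩ U]

/-- A connection `∇ : U → Ω¹(U)` on the `F`-vector space `U`.  As `Ω¹(U) = U dz/z`, one has
`∇ u = (∇_τ u) dz/z` with `∇_τ = ι_τ ∘ ∇ : U → U`, and `∇` is recorded through `∇_τ`, a `k`-linear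
operator satisfying the Leibniz rule for `τ = z d/dz`. -/
structure Connection where
  /-- The operator `∇_τ = ι_τ ∘ ∇`. -/
  op : U →ₗ[k] U
  leibniz : ∀ (f : k⸨X⸩) (u : U), op (f • u) = euler f • u + f • op u

/-- A point `x` of the (enlarged) Bruhat–Tits building of `GL(U)`, given by its periodic filtration
`{U_{x,r}}` by `𝔬`-lattices.  The apartment of a basis `b` consists of the points `a ∈ ℝⁿ`; the line
`k z^m b_i` is homogeneous of degree `a_i + m`, and `U_{x,r}` is the set of vectors all of whose
homogeneous components have degree at least `r`.  The building is the union of the apartments. -/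
structure BuildingPoint where
  /-- The lattice `U_{x,r}`. -/
  filt : ℝ → Submodule k⟦X⟧ U
  exists_apartment : ∃ (b : Module.Basis (Fin (Module.finrank k⸨X⸩ U)) k⸨X⸩ U)
    (a : Fin (Module.finrank k⸨X⸩ U) → ℝ),
    ∀ (r : ℝ) (u : U), u ∈ filt r ↔
      ∀ (i : Fin (Module.finrank k⸨X⸩ U)) (m : ℤ), a i + (m : ℝ) < r → (b.repr u i).coeff m = 0

variable {k U}

theorem C_smul (c : k) (u : U) : (HahnSeries.C c : k⸨X⸩) • u = c • u := by
  rw [← mul_one (HahnSeries.C c : k⸨X⸩), HahnSeries.C_mul_eq_smul, smul_assoc, one_smul]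

instance instSMulCommClass : SMulCommClass k⸨X⸩ k U where
  smul_comm f c u := by
    rw [← C_smul (k := k) c u, ← C_smul (k := k) c (f • u), smul_smul, smul_smul, mul_comm]

namespace BuildingPoint

variable (x : BuildingPoint k U)

theorem filt_antitone : Antitone x.filt := by
  obtain ⟨b, a, h⟩ := x.exists_apartment
  intro r s hrs u hu
  rw [h] at hu ⊢
  exact fun i m hm => hu i m (lt_of_lt_of_le hm hrs)

theorem smul_mem_filt (c : k) {r : ℝ} {u : U} (hu : u ∈ x.filt r) : c • u ∈ x.filt r := by
  obtain ⟨b, a, h⟩ := x.exists_apartment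
  rw [h] at hu ⊢
  intro i m hm
  rw [← C_smul, map_smul, Finsupp.smul_apply, smul_eq_mul, HahnSeries.C_mul_eq_smul,
    HahnSeries.coeff_smul, hu i m hm, smul_zero]

/-- The next step `U_{x,r+} = ⋃_{s > r} U_{x,s}`. -/
def filtPlus (r : ℝ) : Submodule k⟦X⟧ U where
  carrier := {u | ∃ s : ℝ, r < s ∧ u ∈ x.filt s}
  add_mem' := by
    rintro u w ⟨s, hs, hu⟩ ⟨t, ht, hw⟩
    exact ⟨min s t, lt_min hs ht, add_mem (x.filt_antitone (min_le_left s t) hu)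
      (x.filt_antitone (min_le_right s t) hw)⟩
  zero_mem' := ⟨r + 1, by linarith, zero_mem _⟩
  smul_mem' := by
    rintro f u ⟨s, hs, hu⟩
    exact ⟨s, hs, Submodule.smul_mem _ f hu⟩

/-- The induced filtration `𝔤𝔩(U)_{x,r} = {Y | Y(U_{x,s}) ⊆ U_{x,s+r} for all s}` on the
`F`-linear endomorphisms of `U`. -/
def gl (r : ℝ) : Submodule k (Module.End k⸨X⸩ U) where
  carrier := {Y | ∀ s : ℝ, ∀ u ∈ x.filt s, Y u ∈ x.filt (s + r)}
  add_mem' := fun hY hZ s u hu => add_mem (hY s u hu) (hZ s u hu)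
  zero_mem' := fun _ _ _ => zero_mem _
  smul_mem' := fun c _ hY s u hu => x.smul_mem_filt c (hY s u hu)

theorem gl_antitone : Antitone x.gl := fun _ _ hrs _ hY s u hu =>
  x.filt_antitone (by linarith) (hY s u hu)

/-- The next step `𝔤𝔩(U)_{x,r+} = ⋃_{s > r} 𝔤𝔩(U)_{x,s}`. -/
def glPlus (r : ℝ) : Submodule k (Module.End k⸨X⸩ U) where
  carrier := {Y | ∃ s : ℝ, r < s ∧ Y ∈ x.gl s}
  add_mem' := by
    rintro Y Z ⟨s, hs, hY⟩ ⟨t, ht, hZ⟩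
    exact ⟨min s t, lt_min hs ht, add_mem (x.gl_antitone (min_le_left s t) hY)
      (x.gl_antitone (min_le_right s t) hZ)⟩
  zero_mem' := ⟨r + 1, by linarith, zero_mem _⟩
  smul_mem' := by
    rintro c Y ⟨s, hs, hY⟩
    exact ⟨s, hs, Submodule.smul_mem _ c hY⟩

end BuildingPoint

variable (k U) in
/-- A `U`-stratum `(x, r, β)`: a point `x` of the building of `GL(U)`, a real depth `r ≥ 0` and a
`k`-linear functional `β` on `𝔤𝔩(U)_{x,r} / 𝔤𝔩(U)_{x,r+}`. -/
structure Stratum where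
  point : BuildingPoint k U
  depth : ℝ
  depth_nonneg : 0 ≤ depth
  functional : Module.Dual k
    (↥(point.gl depth) ⧸ (point.glPlus depth).submoduleOf (point.gl depth))

namespace Stratum

variable (S : Stratum k U)

/-- `Y ∈ 𝔤𝔩(U)_{x,-r}` represents `β` if `β` is induced by `Z ↦ Res Tr(Y Z) dz/z`.  Here
`𝔤𝔩(U)` is identified with its `F`-dual by the trace form, and the residue of `f dz/z` is the
coefficient of `z^0` in `f`.  The associated one-form `X_β` is `Y dz/z`. -/
def IsRepresentative (Y : Module.End k⸨X⸩ U) : Prop :=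
  Y ∈ S.point.gl (-S.depth) ∧
    ∀ Z : ↥(S.point.gl S.depth),
      S.functional (Submodule.Quotient.mk Z) =
        (LinearMap.trace k⸨X⸩ U (Y * (Z : Module.End k⸨X⸩ U))).coeff 0

/-- A stratum is fundamental if all its representatives are non-nilpotent. -/
def IsFundamental : Prop :=
  ∀ Y : Module.End k⸨X⸩ U, S.IsRepresentative Y → ¬ IsNilpotent Y

end Stratum

/-- The family `e` is contained in `z^m L`. -/
def InShiftedLattice {ι : Type*} (L : Submodule k⟦X⟧ U) (m : ℤ) (e : ι → U) : Prop :=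
  ∀ j, ∃ w ∈ L, e j = (HahnSeries.single m (1 : k) : k⸨X⸩) • w

namespace Connection

variable (D : Connection k U)

/-- `∇` is regular singular if `∇_τ` preserves some `𝔬`-lattice of `U`. -/
def IsRegularSingular : Prop :=
  ∃ L : Submodule k⟦X⟧ U, L.IsLattice k⸨X⸩ ∧ ∀ u ∈ L, D.op u ∈ L

/-- `t` is the slope of `∇`, as computed from the lattice `L` and the basis `e`.  Writing `v(e')` for
the greatest `m` with `e' ⊆ z^m L`, this means: `t = 0` if `∇` is regular singular; otherwise `t` is
positive and the set of the numbers `v(∇_τ^i e) + t i`, `i > 0`, is bounded. -/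
def HasSlope {ι : Type*} (L : Submodule k⟦X⟧ U) (e : Module.Basis ι k⸨X⸩ U) (t : ℚ) : Prop :=
  (D.IsRegularSingular ∧ t = 0) ∨
    (¬ D.IsRegularSingular ∧ 0 < t ∧ ∃ C : ℚ, ∀ i : ℕ, 0 < i → ∃ m : ℤ,
      IsGreatest {m : ℤ | InShiftedLattice L m (fun j => (D.op ^ i) (e j))} m ∧
        |(m : ℚ) + t * (i : ℚ)| ≤ C)

/-- `(U, ∇)` contains the stratum `(x, r, β)`: for a representative `Y dz/z` of `β`,
`(∇ - j dz/z - Y dz/z) U_{x,j} ⊆ Ω¹(U)_{x,(j-r)+}` for all real `j`, where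
`Ω¹(U)_{x,s} = U_{x,s} dz/z`.  (The condition does not depend on the representative.) -/
def Contains [Algebra ℝ k] (S : Stratum k U) : Prop :=
  ∃ Y : Module.End k⸨X⸩ U, S.IsRepresentative Y ∧
    ∀ j : ℝ, ∀ u ∈ S.point.filt j,
      D.op u - algebraMap ℝ k j • u - Y u ∈ S.point.filtPlus (j - S.depth)

end Connection


end Definitions

end FormalConnection

end

/-!
Filter the `k`-linear endomorphisms of `U` by how far they raise the degrees of a point `x` of the
building. If `∇_τ` lowers degrees by at most `r > 0`, then the part of `∇_τ` that is not `F`-linear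
and the scalars `j` in the definition of containment have higher order, so a stratum of depth `r`
contained in `∇` at `x` is fundamental exactly when the symbol of `∇_τ` in degree `-r` is not
nilpotent. A nilpotent symbol makes the iterates of `∇_τ` move down the filtration at a rate
strictly smaller than `r`; a symbol that is not nilpotent makes them move down at the rate `r`
exactly. This rate can be measured with any lattice and any basis, so `r` is then the slope, and no
other point allows a smaller depth.

It remains to find one point at which the symbol is not nilpotent (or `r = 0`). For a cyclic vector
`e`, place `∇_τ^i e` at height `-r i`, where `r` is the steepest slope of the Newton polygon of the
relation satisfied by `e`; this also shows that `r` is rational. In general, let `V` be the span of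
the iterates of a nonzero vector and combine points for `V` and, by induction, for `U ⧸ V`. If the
part of the basis that lifts `U ⧸ V` is moved far down the filtration, then the extension of
`U ⧸ V` by `V` does not affect the order of `∇_τ`.
-/

noncomputable section

namespace FormalConnection

/-! ### Laurent series and points of the building in coordinates -/

theorem exists_pos_forall_le {ι : Type*} [Finite ι] {g : ι → ℝ} (hg : ∀ i, 0 < g i) :
    ∃ ε : ℝ, 0 < ε ∧ ∀ i, ε ≤ g i := by
  have h : ∀ᶠ ε in nhdsWithin (0 : ℝ) (Set.Ioi 0), 0 < ε ∧ ∀ i, ε ≤ g i :=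
    Filter.Eventually.and self_mem_nhdsWithin <| Filter.eventually_all.2 fun i =>
      nhdsWithin_le_nhds (eventually_le_nhds (hg i))
  exact h.exists

section Laurent

variable {k : Type u} [Field k]

/-- All coefficients of `f` in degrees below the real number `c` vanish. -/
def VanishBelow (f : k⸨X⸩) (c : ℝ) : Prop := ∀ m : ℤ, (m : ℝ) < c → f.coeff m = 0

namespace VanishBelow

theorem zero (c : ℝ) : VanishBelow (0 : k⸨X⸩) c := fun _ _ => rfl

theorem mono {f : k⸨X⸩} {c d : ℝ} (hf : VanishBelow f c) (h : d ≤ c) : VanishBelow f d :=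
  fun m hm => hf m (hm.trans_le h)

theorem add {f g : k⸨X⸩} {c : ℝ} (hf : VanishBelow f c) (hg : VanishBelow g c) :
    VanishBelow (f + g) c := fun m hm => by
  rw [HahnSeries.coeff_add, hf m hm, hg m hm, add_zero]

theorem mul {f g : k⸨X⸩} {c d : ℝ} (hf : VanishBelow f c) (hg : VanishBelow g d) :
    VanishBelow (f * g) (c + d) := fun m hm => by
  rw [HahnSeries.coeff_mul]
  refine Finset.sum_eq_zero fun p hp => ?_
  have hp' : (p.1 : ℝ) + p.2 = m := by exact_mod_cast (Finset.mem_antidiagonal.1 hp).2.2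
  rcases lt_or_ge (p.1 : ℝ) c with h | h
  · rw [hf _ h, zero_mul]
  · rw [hg p.2 (by linarith), mul_zero]

theorem euler {f : k⸨X⸩} {c : ℝ} (hf : VanishBelow f c) : VanishBelow (euler f) c :=
  fun m hm => by rw [euler_coeff, hf m hm, mul_zero]

theorem single (m : ℤ) (r : k) : VanishBelow (HahnSeries.single m r) (m : ℝ) := fun l hl =>
  HahnSeries.coeff_single_of_ne (by rintro rfl; exact lt_irrefl _ hl)

theorem one : VanishBelow (1 : k⸨X⸩) 0 := by
  simpa only [Int.cast_zero, HahnSeries.single_zero_one] using single 0 (1 : k)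

theorem exists_of (f : k⸨X⸩) : ∃ c : ℝ, VanishBelow f c :=
  ⟨f.order, fun m hm => HahnSeries.coeff_eq_zero_of_lt_order (by exact_mod_cast hm)⟩

end VanishBelow

theorem vanishBelow_zero_iff {f : k⸨X⸩} :
    VanishBelow f 0 ↔ ∃ g : k⟦X⟧, algebraMap k⟦X⟧ k⸨X⸩ g = f := by
  constructor
  · refine fun hf => ⟨PowerSeries.mk fun n => f.coeff n, HahnSeries.ext (funext fun m => ?_)⟩
    refine (PowerSeries.coeff_coe (PowerSeries.mk fun n => f.coeff n) m).trans ?_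
    split_ifs with h
    · exact (hf m (by exact_mod_cast h)).symm
    · rw [PowerSeries.coeff_mk, Int.natAbs_of_nonneg (not_lt.1 h)]
  · rintro ⟨g, rfl⟩ m hm
    exact (PowerSeries.coeff_coe g m).trans (if_pos (by exact_mod_cast hm))

/-- The part of `f` in the real degree `c`, which is `0` unless `c` is an integer. -/
def degreePart (c : ℝ) (f : k⸨X⸩) : k⸨X⸩ where
  coeff m := open Classical in if (m : ℝ) = c then f.coeff m else 0
  isPWO_support' := f.isPWO_support.mono fun m hm hf => hm <| by simp only [hf, ite_self]

theorem degreePart_coeff_of_eq {c : ℝ} {m : ℤ} (h : (m : ℝ) = c) (f : k⸨X⸩) :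
    (degreePart c f).coeff m = f.coeff m := if_pos h

theorem degreePart_coeff_of_ne {c : ℝ} {m : ℤ} (h : (m : ℝ) ≠ c) (f : k⸨X⸩) :
    (degreePart c f).coeff m = 0 := if_neg h

end Laurent

section Points

variable {k : Type u} [Field k]
variable {U : Type v} [AddCommGroup U] [Module k⸨X⸩ U] [Module k⟦X⟧ U]
variable {ι : Type*}

namespace BuildingPoint

/-- The point `x` lies in the apartment of the basis `b`, with coordinates `a`. -/
def IsAdapted (x : BuildingPoint k U) (b : Module.Basis ι k⸨X⸩ U) (a : ι → ℝ) : Prop :=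
  ∀ (r : ℝ) (u : U), u ∈ x.filt r ↔ ∀ i, VanishBelow (b.repr u i) (r - a i)

theorem exists_isAdapted (x : BuildingPoint k U) :
    ∃ (b : Module.Basis (Fin (Module.finrank k⸨X⸩ U)) k⸨X⸩ U) (a : _ → ℝ), x.IsAdapted b a := by
  obtain ⟨b, a, h⟩ := x.exists_apartment
  refine ⟨b, a, fun r u => (h r u).trans (forall_congr' fun i => forall_congr' fun m => ?_)⟩
  rw [lt_sub_iff_add_lt']

theorem IsAdapted.basis_mem {x : BuildingPoint k U} {b : Module.Basis ι k⸨X⸩ U} {a : ι → ℝ}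
    (h : x.IsAdapted b a) (i : ι) : b i ∈ x.filt (a i) := by
  refine (h _ _).2 fun j => ?_
  rcases eq_or_ne i j with rfl | hij
  · rw [b.repr_self, Finsupp.single_eq_same, sub_self]
    exact VanishBelow.one
  · rw [b.repr_self, Finsupp.single_eq_of_ne hij.symm]
    exact VanishBelow.zero _

theorem smul_mem_filt_add (x : BuildingPoint k U) {f : k⸨X⸩} {c t : ℝ} {u : U}
    (hf : VanishBelow f c) (hu : u ∈ x.filt t) : f • u ∈ x.filt (t + c) := by
  obtain ⟨b, a, h⟩ := x.exists_isAdapted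
  rw [h] at hu ⊢
  intro i
  rw [map_smul, Finsupp.smul_apply, smul_eq_mul]
  exact (hf.mul (hu i)).mono (by linarith)

theorem exists_mem_filt (x : BuildingPoint k U) (u : U) : ∃ t, u ∈ x.filt t := by
  obtain ⟨b, a, h⟩ := x.exists_isAdapted
  choose c hc using fun i => VanishBelow.exists_of (b.repr u i)
  obtain ⟨t, ht⟩ := Finite.exists_ge fun i => c i + a i
  exact ⟨t, (h t u).2 fun i => (hc i).mono (by linarith [ht i])⟩

theorem exists_vanishBelow_repr [Finite ι] (x : BuildingPoint k U) (e : Module.Basis ι k⸨X⸩ U) :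
    ∃ c : ℝ, ∀ t, ∀ u ∈ x.filt t, ∀ j, VanishBelow (e.repr u j) (t - c) := by
  obtain ⟨b, a, h⟩ := x.exists_isAdapted
  choose d hd using fun (i : Fin (Module.finrank k⸨X⸩ U)) (j : ι) =>
    VanishBelow.exists_of (e.repr (b i) j)
  obtain ⟨c, hc⟩ := Finite.exists_le fun p : Fin (Module.finrank k⸨X⸩ U) × ι => a p.1 - d p.1 p.2
  refine ⟨c, fun t u hu j => ?_⟩
  rw [← e.sum_repr_mul_repr b u j]
  exact Finset.sum_induction _ (VanishBelow · (t - c)) (fun _ _ => VanishBelow.add)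
    (VanishBelow.zero _) fun i _ =>
      ((hd i j).mul ((h t u).1 hu i)).mono (by linarith [hc (i, j)])

theorem single_smul_mem_filt (x : BuildingPoint k U) (m : ℤ) {t : ℝ} {u : U} :
    (HahnSeries.single m (1 : k) : k⸨X⸩) • u ∈ x.filt (t + m) ↔ u ∈ x.filt t := by
  refine ⟨fun h => ?_, x.smul_mem_filt_add (VanishBelow.single m 1)⟩
  have := x.smul_mem_filt_add (VanishBelow.single (-m) (1 : k)) h
  rwa [smul_smul, HahnSeries.single_mul_single, neg_add_cancel, mul_one,
    HahnSeries.single_zero_one, one_smul, Int.cast_neg, add_neg_cancel_right] at this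

theorem exists_filt_le (x y : BuildingPoint k U) :
    ∃ c : ℝ, ∀ t, ∀ u ∈ x.filt t, u ∈ y.filt (t - c) := by
  obtain ⟨b, a, h⟩ := y.exists_isAdapted
  obtain ⟨c, hc⟩ := x.exists_vanishBelow_repr b
  obtain ⟨A, hA⟩ := Finite.exists_ge a
  exact ⟨c - A, fun t u hu => (h _ u).2 fun i => (hc t u hu i).mono (by linarith [hA i])⟩

variable [IsScalarTower k⟦X⟧ k⸨X⸩ U]

/-- The point with coordinates `a` in the apartment of the basis `b`. -/
def ofBasis [Fintype ι] (b : Module.Basis ι k⸨X⸩ U) (a : ι → ℝ) : BuildingPoint k U where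
  filt r :=
    { carrier := {u | ∀ i, VanishBelow (b.repr u i) (r - a i)}
      add_mem' := fun hu hw i => by
        rw [map_add, Finsupp.add_apply]
        exact (hu i).add (hw i)
      zero_mem' := fun i => by
        rw [map_zero, Finsupp.zero_apply]
        exact VanishBelow.zero _
      smul_mem' := fun f u hu i => by
        rw [← algebraMap_smul k⸨X⸩ f u, map_smul, Finsupp.smul_apply, smul_eq_mul]
        exact ((vanishBelow_zero_iff.2 ⟨f, rfl⟩).mul (hu i)).mono (by rw [zero_add]) }
  exists_apartment := by
    let σ := Fintype.equivFinOfCardEq (Module.finrank_eq_card_basis b).symm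
    refine ⟨b.reindex σ, a ∘ σ.symm, fun r u => σ.forall_congr fun i => forall_congr' fun m => ?_⟩
    rw [b.repr_reindex_apply, Function.comp_apply, σ.symm_apply_apply, lt_sub_iff_add_lt']

theorem ofBasis_isAdapted [Fintype ι] (b : Module.Basis ι k⸨X⸩ U) (a : ι → ℝ) :
    (ofBasis b a).IsAdapted b a := fun _ _ => Iff.rfl

variable [Module k U] [IsScalarTower k k⸨X⸩ U]

theorem exists_forall_mem_filt [Finite ι] (x : BuildingPoint k U) (e : ι → U) :
    ∃ t, ∀ i, e i ∈ x.filt t := by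
  choose c hc using fun i => x.exists_mem_filt (e i)
  obtain ⟨t, ht⟩ := Finite.exists_ge c
  exact ⟨t, fun i => x.filt_antitone (ht i) (hc i)⟩

namespace IsAdapted

variable {x : BuildingPoint k U} {b : Module.Basis ι k⸨X⸩ U} {a : ι → ℝ}
  [Finite ι]

theorem mem_gl_iff (h : x.IsAdapted b a) {d : ℝ} {T : Module.End k⸨X⸩ U} :
    T ∈ x.gl d ↔ ∀ j, T (b j) ∈ x.filt (a j + d) := by
  refine ⟨fun hT j => hT _ _ (h.basis_mem j), fun hT s u hu => ?_⟩
  have := Fintype.ofFinite ι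
  rw [← b.sum_repr u, map_sum]
  refine sum_mem fun i _ => ?_
  rw [map_smul]
  exact x.filt_antitone (by linarith) (x.smul_mem_filt_add ((h s u).1 hu i) (hT i))

/- Degrees `a i + m` of homogeneous components are discrete, so the filtration has no jump in a
right neighbourhood of `t`. -/
theorem mem_filtPlus_iff (h : x.IsAdapted b a) {t : ℝ} {u : U} :
    u ∈ x.filtPlus t ↔ ∀ i (m : ℤ), a i + m ≤ t → (b.repr u i).coeff m = 0 := by
  constructor
  · rintro ⟨s, hs, hu⟩ i m hm
    exact (h s u).1 hu i m (by linarith)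
  · intro hu
    obtain ⟨ε, hε, hs⟩ := exists_pos_forall_le (g := fun i => a i + (⌊t - a i⌋ + 1) - t)
      fun i => by linarith [Int.lt_floor_add_one (t - a i)]
    refine ⟨t + ε, by linarith, (h _ u).2 fun i m hm => hu i m ?_⟩
    have hm' : m ≤ ⌊t - a i⌋ := Int.lt_add_one_iff.1 <| by
      exact_mod_cast (by linarith [hs i] : (m : ℝ) < ⌊t - a i⌋ + 1)
    linarith [Int.le_floor.1 hm']

theorem mem_glPlus_iff (h : x.IsAdapted b a) {d : ℝ} {T : Module.End k⸨X⸩ U} :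
    T ∈ x.glPlus d ↔ ∀ j, T (b j) ∈ x.filtPlus (a j + d) := by
  constructor
  · rintro ⟨s, hs, hT⟩ j
    exact ⟨a j + s, by linarith, h.mem_gl_iff.1 hT j⟩
  · intro hT
    choose s hs hT using hT
    obtain ⟨ε, hε, hle⟩ := exists_pos_forall_le fun j => sub_pos.2 (hs j)
    exact ⟨d + ε, by linarith, h.mem_gl_iff.2 fun j =>
      x.filt_antitone (by linarith [hle j]) (hT j)⟩

end IsAdapted

end BuildingPoint

end Points

/-! ### Symbols of operators -/

section Operators

variable {k : Type u} [Field k]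
variable {U : Type v} [AddCommGroup U] [Module k⸨X⸩ U] [Module k⟦X⟧ U]
  [IsScalarTower k⟦X⟧ k⸨X⸩ U] [Module k U] [IsScalarTower k k⸨X⸩ U]

namespace BuildingPoint

variable (x : BuildingPoint k U)

/-- The `k`-linear operators on `U` that raise degrees by at least `d`. They contain `𝔤𝔩(U)_{x,d}`,
but also operators such as `∇_τ` that are not `F`-linear. -/
def operators (d : ℝ) : Submodule k (Module.End k U) where
  carrier := {T | ∀ s : ℝ, ∀ u ∈ x.filt s, T u ∈ x.filt (s + d)}
  add_mem' := fun hT hS s u hu => add_mem (hT s u hu) (hS s u hu)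
  zero_mem' := fun _ _ _ => zero_mem _
  smul_mem' := fun c _ hT s u hu => x.smul_mem_filt c (hT s u hu)

variable {x}

theorem restrictScalars_mem_operators {d : ℝ} {Y : Module.End k⸨X⸩ U} :
    Y.restrictScalars k ∈ x.operators d ↔ Y ∈ x.gl d := Iff.rfl

theorem operators_antitone : Antitone x.operators := fun _ _ hrs _ hT s u hu =>
  x.filt_antitone (by linarith) (hT s u hu)

theorem one_mem_operators : (1 : Module.End k U) ∈ x.operators 0 := fun s u hu => by
  rwa [add_zero]

theorem mul_mem_operators {d d' : ℝ} {T S : Module.End k U} (hT : T ∈ x.operators d)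
    (hS : S ∈ x.operators d') : T * S ∈ x.operators (d + d') := fun s u hu =>
  x.filt_antitone (by linarith) (hT _ _ (hS s u hu))

theorem pow_mem_operators {d : ℝ} {T : Module.End k U} (hT : T ∈ x.operators d) (N : ℕ) :
    T ^ N ∈ x.operators (N * d) := by
  induction N with
  | zero => simpa only [pow_zero, Nat.cast_zero, zero_mul] using one_mem_operators
  | succ N ih =>
    rw [pow_succ, Nat.cast_succ, add_one_mul]
    exact mul_mem_operators ih hT

variable (x) in
/-- The `k`-linear operators on `U` that raise degrees by at least some `s > d`. -/
def operatorsPlus (d : ℝ) : Submodule k (Module.End k U) where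
  carrier := {T | ∃ s : ℝ, d < s ∧ T ∈ x.operators s}
  add_mem' := by
    rintro T S ⟨s, hs, hT⟩ ⟨t, ht, hS⟩
    exact ⟨min s t, lt_min hs ht, add_mem (operators_antitone (min_le_left s t) hT)
      (operators_antitone (min_le_right s t) hS)⟩
  zero_mem' := ⟨d + 1, by linarith, zero_mem _⟩
  smul_mem' := by
    rintro c T ⟨s, hs, hT⟩
    exact ⟨s, hs, Submodule.smul_mem _ c hT⟩

theorem operatorsPlus_le_operators (d : ℝ) : x.operatorsPlus d ≤ x.operators d := by
  rintro T ⟨s, hs, hT⟩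
  exact operators_antitone hs.le hT

theorem operators_le_operatorsPlus {d d' : ℝ} (h : d < d') : x.operators d' ≤ x.operatorsPlus d :=
  fun _ hT => ⟨d', h, hT⟩

theorem mul_mem_operatorsPlus_left {d d' : ℝ} {T S : Module.End k U} (hT : T ∈ x.operatorsPlus d)
    (hS : S ∈ x.operators d') : T * S ∈ x.operatorsPlus (d + d') := by
  obtain ⟨s, hs, hT⟩ := hT
  exact ⟨s + d', by linarith, mul_mem_operators hT hS⟩

theorem mul_mem_operatorsPlus_right {d d' : ℝ} {T S : Module.End k U} (hT : T ∈ x.operators d)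
    (hS : S ∈ x.operatorsPlus d') : T * S ∈ x.operatorsPlus (d + d') := by
  obtain ⟨s, hs, hS⟩ := hS
  exact ⟨d + s, by linarith, mul_mem_operators hT hS⟩

theorem pow_sub_pow_mem_operatorsPlus {d : ℝ} {T S : Module.End k U} (hT : T ∈ x.operators d)
    (hS : S ∈ x.operators d) (h : T - S ∈ x.operatorsPlus d) (N : ℕ) :
    T ^ N - S ^ N ∈ x.operatorsPlus (N * d) := by
  induction N with
  | zero => simp only [pow_zero, sub_self, zero_mem]
  | succ N ih =>
    have hsplit : T ^ (N + 1) - S ^ (N + 1) = T ^ N * (T - S) + (T ^ N - S ^ N) * S := by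
      rw [pow_succ, pow_succ, mul_sub, sub_mul]
      abel
    rw [hsplit, Nat.cast_succ, add_one_mul]
    exact add_mem (mul_mem_operatorsPlus_right (pow_mem_operators hT N) h)
      (mul_mem_operatorsPlus_left ih hS)

variable (x) in
/-- The class of `T ∈ x.operators d` in degree `d` of the associated graded ring of the filtration
`x.operators` is nilpotent. -/
def HasNilpotentSymbol (d : ℝ) (T : Module.End k U) : Prop :=
  ∃ N : ℕ, T ^ N ∈ x.operatorsPlus (N * d)

namespace HasNilpotentSymbol

variable {d : ℝ} {T S : Module.End k U}

theorem of_isNilpotent (hT : IsNilpotent T) : x.HasNilpotentSymbol d T := by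
  obtain ⟨N, hN⟩ := hT
  exact ⟨N, by rw [hN]; exact zero_mem _⟩

theorem of_sub_mem (hT : T ∈ x.operators d) (h : T - S ∈ x.operatorsPlus d)
    (hnil : x.HasNilpotentSymbol d T) : x.HasNilpotentSymbol d S := by
  obtain ⟨N, hN⟩ := hnil
  have hS : S ∈ x.operators d := by
    simpa only [sub_sub_cancel] using sub_mem hT (operatorsPlus_le_operators d h)
  have hSN := sub_mem hN (pow_sub_pow_mem_operatorsPlus hT hS h N)
  rw [sub_sub_cancel] at hSN
  exact ⟨N, hSN⟩

/- Each block of `M` factors gains a further `ε`, so on average the powers of `T` raise degrees by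
`d + ε / M` per factor. -/
theorem exists_lt_forall_pow_mem (hT : T ∈ x.operators d) (hnil : x.HasNilpotentSymbol d T) :
    ∃ d' > d, ∃ C : ℝ, ∀ i : ℕ, T ^ i ∈ x.operators (i * d' - C) := by
  obtain ⟨M, hM, ε, hε, hTM⟩ :
      ∃ M : ℕ, 0 < M ∧ ∃ ε > 0, T ^ M ∈ x.operators (M * d + ε) := by
    obtain ⟨N, s, hs, hN⟩ := hnil
    refine ⟨N + 1, N.succ_pos, s - N * d, sub_pos.2 hs, ?_⟩
    rw [pow_succ]
    exact operators_antitone (by push_cast; linarith) (mul_mem_operators hN hT)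
  have hM' : (0 : ℝ) < M := Nat.cast_pos.2 hM
  refine ⟨d + ε / M, lt_add_of_pos_right d (div_pos hε hM'), ε, fun i => ?_⟩
  have hi : ((i : ℕ) : ℝ) = M * (i / M : ℕ) + (i % M : ℕ) := by
    exact_mod_cast (Nat.div_add_mod i M).symm
  have hmod : ((i % M : ℕ) : ℝ) * (ε / M) ≤ ε := by
    rw [mul_div_assoc', div_le_iff₀ hM', mul_comm]
    exact mul_le_mul_of_nonneg_left (Nat.cast_le.2 (Nat.mod_lt i hM).le) hε.le
  have hdiv : (M : ℝ) * (i / M : ℕ) * (ε / M) = (i / M : ℕ) * ε := by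
    field_simp
  rw [← Nat.div_add_mod i M, pow_add, pow_mul, Nat.div_add_mod]
  refine operators_antitone ?_ (mul_mem_operators (pow_mem_operators hTM _)
    (pow_mem_operators hT _))
  rw [hi]
  linarith

end HasNilpotentSymbol

end BuildingPoint

end Operators

section Homogeneous

variable {k : Type u} [Field k]
variable {U : Type v} [AddCommGroup U] [Module k⸨X⸩ U] {ι : Type*}
variable {b : Module.Basis ι k⸨X⸩ U} {a : ι → ℝ}

variable (b a) in
/-- The vector `u` is homogeneous of degree `t` for the grading in which `z^m b_i` has degree
`a_i + m`. -/
def IsHomogeneous (t : ℝ) (u : U) : Prop :=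
  ∀ i (m : ℤ), (b.repr u i).coeff m ≠ 0 → a i + m = t

theorem isHomogeneous_basis (j : ι) : IsHomogeneous b a (a j) (b j) := fun i m hm => by
  rw [b.repr_self] at hm
  rcases eq_or_ne i j with rfl | hij
  · rw [Finsupp.single_eq_same, HahnSeries.coeff_one] at hm
    rw [of_not_not fun h => hm (if_neg h), Int.cast_zero, add_zero]
  · rw [Finsupp.single_eq_of_ne hij] at hm
    exact absurd rfl hm

theorem IsHomogeneous.apply [Finite ι] {d t : ℝ} {E : Module.End k⸨X⸩ U} {u : U}
    (hE : ∀ j, IsHomogeneous b a (a j + d) (E (b j))) (hu : IsHomogeneous b a t u) :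
    IsHomogeneous b a (t + d) (E u) := by
  classical
  have := Fintype.ofFinite ι
  intro i m hm
  rw [← LinearMap.toMatrix_mulVec_repr b b E u, Matrix.mulVec_eq_sum, Finset.sum_apply,
    HahnSeries.coeff_sum] at hm
  obtain ⟨l, -, hl⟩ := Finset.exists_ne_zero_of_sum_ne_zero hm
  rw [Pi.smul_apply, op_smul_eq_mul, Matrix.transpose_apply, LinearMap.toMatrix_apply,
    HahnSeries.coeff_mul] at hl
  obtain ⟨p, hp, hpm⟩ := Finset.exists_ne_zero_of_sum_ne_zero hl
  have hp' : (p.1 : ℝ) + p.2 = m := by exact_mod_cast (Finset.mem_antidiagonal.1 hp).2.2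
  linarith [hE l i p.1 (left_ne_zero_of_mul hpm), hu l p.2 (right_ne_zero_of_mul hpm)]

theorem IsHomogeneous.pow_apply [Finite ι] {d t : ℝ} {E : Module.End k⸨X⸩ U} {u : U}
    (hE : ∀ j, IsHomogeneous b a (a j + d) (E (b j))) (hu : IsHomogeneous b a t u) (N : ℕ) :
    IsHomogeneous b a (t + N * d) ((E ^ N) u) := by
  induction N with
  | zero => simpa only [Nat.cast_zero, zero_mul, add_zero, pow_zero, Module.End.one_apply] using hu
  | succ N ih =>
    rw [pow_succ', Module.End.mul_apply, Nat.cast_succ, add_one_mul, ← add_assoc]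
    exact ih.apply hE

section HomogeneousPart

variable [Fintype ι]

variable (b a) in
/-- The homogeneous component of degree `t` of the vector `u`. -/
def homogeneousPart (t : ℝ) (u : U) : U := ∑ i, degreePart (t - a i) (b.repr u i) • b i

theorem repr_homogeneousPart (t : ℝ) (u : U) (i : ι) :
    b.repr (homogeneousPart b a t u) i = degreePart (t - a i) (b.repr u i) := by
  rw [homogeneousPart, b.repr_sum_self]

theorem homogeneousPart_isHomogeneous (t : ℝ) (u : U) :
    IsHomogeneous b a t (homogeneousPart b a t u) := fun i m hm => by
  rw [repr_homogeneousPart] at hm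
  by_contra h
  exact hm (degreePart_coeff_of_ne (fun h' => h (by linarith)) _)

theorem IsHomogeneous.homogeneousPart_eq {t : ℝ} {u : U} (hu : IsHomogeneous b a t u) :
    homogeneousPart b a t u = u := by
  refine b.ext_elem fun i => HahnSeries.ext (funext fun m => ?_)
  rw [repr_homogeneousPart]
  by_cases h : (m : ℝ) = t - a i
  · exact degreePart_coeff_of_eq h _
  · rw [degreePart_coeff_of_ne h]
    by_contra hm
    exact h (by linarith [hu i m (Ne.symm hm)])

variable (b a) in
/-- The homogeneous component of degree `d` of the endomorphism `T`: it maps `b_j` to the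
homogeneous component of `T b_j` in degree `a_j + d`. -/
def leadingTerm (d : ℝ) (T : Module.End k⸨X⸩ U) : Module.End k⸨X⸩ U :=
  b.constr k⸨X⸩ fun j => homogeneousPart b a (a j + d) (T (b j))

theorem leadingTerm_basis (d : ℝ) (T : Module.End k⸨X⸩ U) (j : ι) :
    leadingTerm b a d T (b j) = homogeneousPart b a (a j + d) (T (b j)) :=
  b.constr_basis _ _ _

theorem leadingTerm_basis_isHomogeneous (d : ℝ) (T : Module.End k⸨X⸩ U) (j : ι) :
    IsHomogeneous b a (a j + d) (leadingTerm b a d T (b j)) := by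
  rw [leadingTerm_basis]
  exact homogeneousPart_isHomogeneous _ _

end HomogeneousPart

variable [Module k⟦X⟧ U] [IsScalarTower k⟦X⟧ k⸨X⸩ U] [Module k U] [IsScalarTower k k⸨X⸩ U]
variable {x : BuildingPoint k U}

theorem IsHomogeneous.eq_zero [Finite ι] {t : ℝ} {u : U} (hu : IsHomogeneous b a t u)
    (h : x.IsAdapted b a) (hu' : u ∈ x.filtPlus t) : u = 0 := by
  refine b.ext_elem fun i => HahnSeries.ext (funext fun m => ?_)
  rw [map_zero, Finsupp.zero_apply, HahnSeries.coeff_zero]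
  by_contra hm
  exact hm (h.mem_filtPlus_iff.1 hu' i m (hu i m hm).le)

namespace BuildingPoint.IsAdapted

variable [Fintype ι]

theorem sub_homogeneousPart_mem (h : x.IsAdapted b a) {t : ℝ} {u : U} (hu : u ∈ x.filt t) :
    u - homogeneousPart b a t u ∈ x.filtPlus t := by
  refine h.mem_filtPlus_iff.2 fun i m hm => ?_
  rw [map_sub, Finsupp.sub_apply, repr_homogeneousPart, HahnSeries.coeff_sub]
  rcases eq_or_ne (m : ℝ) (t - a i) with heq | hne
  · rw [degreePart_coeff_of_eq heq, sub_self]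
  · rw [degreePart_coeff_of_ne hne, sub_zero]
    exact (h t u).1 hu i m (lt_of_le_of_ne (by linarith) hne)

theorem sub_leadingTerm_mem (h : x.IsAdapted b a) {d : ℝ} {T : Module.End k⸨X⸩ U}
    (hT : T ∈ x.gl d) : T - leadingTerm b a d T ∈ x.glPlus d := by
  refine h.mem_glPlus_iff.2 fun j => ?_
  rw [LinearMap.sub_apply, leadingTerm_basis]
  exact h.sub_homogeneousPart_mem (hT _ _ (h.basis_mem j))

theorem hasNilpotentSymbol_iff (h : x.IsAdapted b a) {d : ℝ} {T : Module.End k⸨X⸩ U}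
    (hT : T ∈ x.gl d) :
    x.HasNilpotentSymbol d (T.restrictScalars k) ↔ IsNilpotent (leadingTerm b a d T) := by
  set E := leadingTerm b a d T
  have hpow (N : ℕ) : E.restrictScalars k ^ N = (E ^ N).restrictScalars k :=
    LinearMap.ext fun u => by
      simp only [Module.End.pow_apply, LinearMap.coe_restrictScalars]
  have hsub : T.restrictScalars k - E.restrictScalars k ∈ x.operatorsPlus d :=
    h.sub_leadingTerm_mem hT
  constructor
  · intro hnil
    obtain ⟨N, hN⟩ := hnil.of_sub_mem hT hsub
    rw [hpow] at hN
    refine ⟨N, b.ext fun j => ?_⟩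
    exact ((isHomogeneous_basis j).pow_apply (leadingTerm_basis_isHomogeneous d T) N).eq_zero h
      (h.mem_glPlus_iff.1 hN j)
  · rintro ⟨N, hN⟩
    have hnil : IsNilpotent (E.restrictScalars k) := ⟨N, by rw [hpow, hN]; rfl⟩
    have hET : E.restrictScalars k - T.restrictScalars k ∈ x.operatorsPlus d := by
      simpa only [neg_sub] using neg_mem hsub
    have hEmem : E.restrictScalars k ∈ x.operators d := by
      simpa only [sub_sub_cancel] using
        sub_mem (show T.restrictScalars k ∈ x.operators d from hT)
          (BuildingPoint.operatorsPlus_le_operators d hsub)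
    exact (BuildingPoint.HasNilpotentSymbol.of_isNilpotent hnil).of_sub_mem hEmem hET

end BuildingPoint.IsAdapted

end Homogeneous

/-! ### The symbol and the growth of the iterates -/

namespace Connection

variable {k : Type u} [Field k]
variable {U : Type v} [AddCommGroup U] [Module k⸨X⸩ U] [Module k U] {ι : Type*}
variable (D : Connection k U)

section Linearization

/-- The `F`-linear endomorphism that agrees with `∇_τ` on the basis `b`. -/
def linearization (b : Module.Basis ι k⸨X⸩ U) : Module.End k⸨X⸩ U :=
  b.constr k⸨X⸩ fun j => D.op (b j)

theorem linearization_basis (b : Module.Basis ι k⸨X⸩ U) (j : ι) :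
    D.linearization b (b j) = D.op (b j) := b.constr_basis _ _ _

theorem repr_op_sub_linearization [Finite ι] (b : Module.Basis ι k⸨X⸩ U) (u : U) (j : ι) :
    b.repr (D.op u - D.linearization b u) j = euler (b.repr u j) := by
  have := Fintype.ofFinite ι
  have hsum : D.op u - D.linearization b u = ∑ i, euler (b.repr u i) • b i := by
    conv_lhs => rw [← b.sum_repr u]
    simp only [map_sum, D.leibniz, map_smul, linearization_basis, ← Finset.sum_sub_distrib,
      add_sub_cancel_right]
  rw [hsum, b.repr_sum_self]

variable [Module k⟦X⟧ U] [IsScalarTower k⟦X⟧ k⸨X⸩ U] [IsScalarTower k k⸨X⸩ U]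
variable [Finite ι] {x : BuildingPoint k U} {b : Module.Basis ι k⸨X⸩ U} {a : ι → ℝ}

theorem op_sub_linearization_mem (h : x.IsAdapted b a) :
    D.op - (D.linearization b).restrictScalars k ∈ x.operators 0 := fun s u hu => by
  refine (h _ _).2 fun j => ?_
  rw [LinearMap.sub_apply, LinearMap.coe_restrictScalars, repr_op_sub_linearization, add_zero]
  exact ((h s u).1 hu j).euler

theorem op_mem_operators_of_basis (h : x.IsAdapted b a) {r : ℝ} (hr : 0 ≤ r)
    (hD : ∀ j, D.op (b j) ∈ x.filt (a j - r)) : D.op ∈ x.operators (-r) := by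
  have hlin : (D.linearization b).restrictScalars k ∈ x.operators (-r) :=
    BuildingPoint.restrictScalars_mem_operators.2 <| h.mem_gl_iff.2 fun j => by
      rw [linearization_basis, ← sub_eq_add_neg]
      exact hD j
  simpa only [sub_add_cancel] using
    add_mem (BuildingPoint.operators_antitone (neg_nonpos.2 hr) (D.op_sub_linearization_mem h)) hlin

end Linearization

variable [Module k⟦X⟧ U]

theorem pow_smul_mem {x : BuildingPoint k U} (i : ℕ) {u : U} {f : k⸨X⸩} {c T : ℝ}
    (hf : VanishBelow f c)
    (hu : ∀ l ≤ i, (D.op ^ l) u ∈ x.filt T) : (D.op ^ i) (f • u) ∈ x.filt (T + c) := by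
  induction i generalizing u f with
  | zero => exact x.smul_mem_filt_add hf (hu 0 le_rfl)
  | succ i ih =>
    rw [pow_succ, Module.End.mul_apply, D.leibniz, map_add]
    refine add_mem (ih hf.euler fun l hl => hu l (by omega)) (ih hf fun l hl => ?_)
    simpa only [pow_succ, Module.End.mul_apply] using hu (l + 1) (by omega)

section Growth

/-- The iterates of `∇_τ` on the family `e` move at most `r` steps down the filtration of `y` at a
time, up to a bounded error. -/
def GrowsAtMost (y : BuildingPoint k U) (e : ι → U) (r : ℝ) : Prop :=
  ∃ C : ℝ, ∀ i : ℕ, 0 < i → ∀ j, (D.op ^ i) (e j) ∈ y.filt (-(r * i) - C)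

/-- The iterates of `∇_τ` on the family `e` move at least `r` steps down the filtration of `y` at a
time, up to a bounded error. -/
def GrowsAtLeast (y : BuildingPoint k U) (e : ι → U) (r : ℝ) : Prop :=
  ∃ C : ℝ, ∀ i : ℕ, 0 < i → ∃ j, (D.op ^ i) (e j) ∉ y.filt (-(r * i) + C)

variable {D} [IsScalarTower k⟦X⟧ k⸨X⸩ U] [IsScalarTower k k⸨X⸩ U]
variable {x y : BuildingPoint k U} {r r' : ℝ}

theorem GrowsAtLeast.le {e : ι → U} (h : D.GrowsAtLeast y e r) (h' : D.GrowsAtMost y e r') :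
    r ≤ r' := by
  obtain ⟨C, hC⟩ := h
  obtain ⟨C', hC'⟩ := h'
  by_contra! hlt
  obtain ⟨i, hi⟩ := exists_nat_gt ((C + C') / (r - r'))
  rw [div_lt_iff₀ (sub_pos.2 hlt)] at hi
  have hstep : (i : ℝ) * (r - r') ≤ (i + 1 : ℕ) * (r - r') :=
    mul_le_mul_of_nonneg_right (by push_cast; linarith) (sub_pos.2 hlt).le
  obtain ⟨j, hj⟩ := hC (i + 1) i.succ_pos
  exact hj (y.filt_antitone (by linarith) (hC' (i + 1) i.succ_pos j))

theorem GrowsAtLeast.change_point {e : ι → U} (h : D.GrowsAtLeast x e r) :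
    D.GrowsAtLeast y e r := by
  obtain ⟨C, hC⟩ := h
  obtain ⟨c, hc⟩ := y.exists_filt_le x
  refine ⟨C + c, fun i hi => (hC i hi).imp fun j hj hy => hj ?_⟩
  exact x.filt_antitone (by linarith) (hc _ _ hy)

theorem growsAtMost_of_pow_mem [Finite ι] {C : ℝ}
    (h : ∀ i : ℕ, D.op ^ i ∈ x.operators (i * -r - C)) (y : BuildingPoint k U) (e : ι → U) :
    D.GrowsAtMost y e r := by
  obtain ⟨c, hc⟩ := x.exists_filt_le y
  obtain ⟨T, hT⟩ := x.exists_forall_mem_filt e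
  exact ⟨C + c - T, fun i _ j => y.filt_antitone (by linarith) (hc _ _ (h i _ _ (hT j)))⟩

theorem growsAtMost_of_mem [Finite ι] (hD : D.op ∈ x.operators (-r)) (y : BuildingPoint k U)
    (e : ι → U) : D.GrowsAtMost y e r :=
  growsAtMost_of_pow_mem (C := 0)
    (fun i => by rw [sub_zero]; exact BuildingPoint.pow_mem_operators hD i) y e

theorem exists_lt_growsAtMost [Finite ι] (hD : D.op ∈ x.operators (-r))
    (hnil : x.HasNilpotentSymbol (-r) D.op) (y : BuildingPoint k U) (e : ι → U) :
    ∃ r' < r, D.GrowsAtMost y e r' := by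
  obtain ⟨d, hd, C, hC⟩ := hnil.exists_lt_forall_pow_mem hD
  exact ⟨-d, by linarith, growsAtMost_of_pow_mem (by simpa only [neg_neg] using hC) y e⟩

theorem exists_pow_mem_operators_of_basis [Finite ι] (x : BuildingPoint k U)
    (e : Module.Basis ι k⸨X⸩ U) :
    ∃ c, ∀ i T, (∀ l ≤ i, ∀ j, (D.op ^ l) (e j) ∈ x.filt T) → D.op ^ i ∈ x.operators (T - c) := by
  have := Fintype.ofFinite ι
  obtain ⟨c, hc⟩ := x.exists_vanishBelow_repr e
  refine ⟨c, fun i T hT s u hu => ?_⟩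
  rw [← e.sum_repr u, map_sum]
  exact sum_mem fun j _ => x.filt_antitone (by linarith)
    (D.pow_smul_mem i (hc s u hu j) fun l hl => hT l hl j)

/- If the iterates up to the `i`-th reach only slowly down the filtration, then so do `K` further
ones for any fixed `K`; for `K` large this makes the symbol of `∇_τ ^ (i + K)` in degree
`-r * (i + K)` vanish. -/
theorem growsAtLeast_of_not_hasNilpotentSymbol [Finite ι] (hr : 0 < r)
    (hD : D.op ∈ x.operators (-r)) (hnil : ¬ x.HasNilpotentSymbol (-r) D.op)
    (y : BuildingPoint k U) (e : Module.Basis ι k⸨X⸩ U) : D.GrowsAtLeast y e r := by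
  suffices D.GrowsAtLeast x e r from this.change_point
  obtain ⟨c, hc⟩ := exists_pow_mem_operators_of_basis (D := D) x e
  obtain ⟨t, ht⟩ := x.exists_forall_mem_filt e
  obtain ⟨K, hK⟩ := exists_nat_gt ((c + 1 - t) / r)
  rw [div_lt_iff₀ hr] at hK
  refine ⟨c + 1, fun i _ => ?_⟩
  by_contra! hslow
  refine hnil ⟨i + K, BuildingPoint.operators_le_operatorsPlus (lt_add_one _) <|
    BuildingPoint.operators_antitone (by linarith)
      (hc (i + K) (-(r * (i + K : ℕ)) + (c + 1)) fun l hl j => ?_)⟩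
  rcases le_total l i with hli | hil
  · have hlr : (l : ℝ) * r ≤ i * r := mul_le_mul_of_nonneg_right (Nat.cast_le.2 hli) hr.le
    refine x.filt_antitone ?_ (BuildingPoint.pow_mem_operators hD l _ _ (ht j))
    push_cast
    linarith
  · obtain ⟨p, rfl⟩ := Nat.exists_eq_add_of_le' hil
    have hpr : (p : ℝ) * r ≤ K * r :=
      mul_le_mul_of_nonneg_right (Nat.cast_le.2 (by omega)) hr.le
    rw [pow_add, Module.End.mul_apply]
    refine x.filt_antitone ?_ (BuildingPoint.pow_mem_operators hD p _ _ (hslow j))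
    push_cast
    linarith

end Growth

end Connection

/-! ### Strata -/

section Strata

variable {k : Type u} [Field k]
variable {U : Type v} [AddCommGroup U] [Module k⸨X⸩ U]

theorem coeff_zero_trace_mul_smulRight {ι : Type*} [Finite ι] {T : Module.End k⸨X⸩ U}
    (b : Module.Basis ι k⸨X⸩ U) (i j : ι) (m : ℤ) : (LinearMap.trace k⸨X⸩ U
      (T * (b.coord i).smulRight ((HahnSeries.single (-m) (1 : k) : k⸨X⸩) • b j))).coeff 0 =
      (b.repr (T (b j)) i).coeff m := by
  have := Module.Finite.of_basis b
  have hcomp (u : U) : T * (b.coord i).smulRight u = (b.coord i).smulRight (T u) :=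
    LinearMap.ext fun v => T.map_smul _ u
  rw [hcomp, LinearMap.trace_smulRight, map_smul, map_smul, smul_eq_mul, b.coord_apply,
    ← add_neg_cancel m, HahnSeries.coeff_single_mul_add, one_mul]

variable [Module k⟦X⟧ U] [IsScalarTower k⟦X⟧ k⸨X⸩ U] [Module k U] [IsScalarTower k k⸨X⸩ U]

namespace BuildingPoint

variable {x : BuildingPoint k U} {d r : ℝ} {T Y : Module.End k⸨X⸩ U}

theorem glPlus_le_gl (d : ℝ) : x.glPlus d ≤ x.gl d := by
  rintro T ⟨s, hs, hT⟩
  exact x.gl_antitone hs.le hT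

theorem coeff_zero_trace_of_mem_glPlus (hT : T ∈ x.glPlus 0) :
    (LinearMap.trace k⸨X⸩ U T).coeff 0 = 0 := by
  obtain ⟨b, a, h⟩ := x.exists_isAdapted
  simp only [LinearMap.trace_eq_matrix_trace k⸨X⸩ b, Matrix.trace, Matrix.diag_apply,
    LinearMap.toMatrix_apply, HahnSeries.coeff_sum]
  refine Finset.sum_eq_zero fun i _ => ?_
  exact h.mem_filtPlus_iff.1 (h.mem_glPlus_iff.1 hT i) i 0 (by rw [Int.cast_zero])

theorem coeff_zero_trace_mul_left (hY : Y ∈ x.gl (-r)) (hT : T ∈ x.glPlus r) :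
    (LinearMap.trace k⸨X⸩ U (Y * T)).coeff 0 = 0 := by
  have hYT : Y * T ∈ x.glPlus (-r + r) :=
    mul_mem_operatorsPlus_right (T := Y.restrictScalars k) (S := T.restrictScalars k) hY hT
  rw [neg_add_cancel] at hYT
  exact coeff_zero_trace_of_mem_glPlus hYT

theorem coeff_zero_trace_mul_right (hY : Y ∈ x.glPlus (-r)) (hT : T ∈ x.gl r) :
    (LinearMap.trace k⸨X⸩ U (Y * T)).coeff 0 = 0 := by
  have hYT : Y * T ∈ x.glPlus (-r + r) :=
    mul_mem_operatorsPlus_left (T := Y.restrictScalars k) (S := T.restrictScalars k) hY hT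
  rw [neg_add_cancel] at hYT
  exact coeff_zero_trace_of_mem_glPlus hYT

theorem IsAdapted.smulRight_mem_gl {ι : Type*} [Finite ι] {b : Module.Basis ι k⸨X⸩ U} {a : ι → ℝ}
    (h : x.IsAdapted b a) (i : ι) {u : U} (hu : u ∈ x.filt (a i + d)) :
    (b.coord i).smulRight u ∈ x.gl d := by
  refine h.mem_gl_iff.2 fun l => ?_
  rw [LinearMap.smulRight_apply, b.coord_apply, b.repr_self]
  rcases eq_or_ne l i with rfl | hl
  · rwa [Finsupp.single_eq_same, one_smul]
  · rw [Finsupp.single_eq_of_ne hl.symm, zero_smul]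
    exact zero_mem _

theorem mem_glPlus_of_coeff_zero_trace_mul (hT : T ∈ x.gl (-r))
    (h0 : ∀ Z ∈ x.gl r, (LinearMap.trace k⸨X⸩ U (T * Z)).coeff 0 = 0) : T ∈ x.glPlus (-r) := by
  obtain ⟨b, a, h⟩ := x.exists_isAdapted
  refine h.mem_glPlus_iff.2 fun j => h.mem_filtPlus_iff.2 fun i m hm => ?_
  rcases hm.lt_or_eq with hlt | heq
  · exact (h _ _).1 (h.mem_gl_iff.1 hT j) i m (by linarith)
  · rw [← coeff_zero_trace_mul_smulRight]
    refine h0 _ (h.smulRight_mem_gl i ?_)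
    rw [show a i + r = a j + (-m : ℤ) by push_cast; linarith, single_smul_mem_filt]
    exact h.basis_mem j

variable (x) in
/-- The functional `Z ↦ Res Tr(Y Z) dz/z` on `𝔤𝔩(U)_{x,r}`. -/
def residuePairing (r : ℝ) (Y : Module.End k⸨X⸩ U) : Module.Dual k (x.gl r) where
  toFun Z := (LinearMap.trace k⸨X⸩ U (Y * (Z : Module.End k⸨X⸩ U))).coeff 0
  map_add' Z W := by
    rw [Submodule.coe_add, mul_add, map_add, HahnSeries.coeff_add]
  map_smul' c Z := by
    have hC : Y * ((c • Z : x.gl r) : Module.End k⸨X⸩ U) =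
        (HahnSeries.C c : k⸨X⸩) • (Y * (Z : Module.End k⸨X⸩ U)) := LinearMap.ext fun u => by
      rw [Module.End.mul_apply, Submodule.coe_smul, LinearMap.smul_apply, ← C_smul, map_smul,
        LinearMap.smul_apply, Module.End.mul_apply]
    rw [hC, map_smul, smul_eq_mul, HahnSeries.C_mul_eq_smul, HahnSeries.coeff_smul,
      RingHom.id_apply]

/-- The stratum `(x, r, β)` for which `β` is represented by `Y`. -/
def stratum (hr : 0 ≤ r) (hY : Y ∈ x.gl (-r)) : Stratum k U where
  point := x
  depth := r
  depth_nonneg := hr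
  functional := Submodule.liftQ _ (x.residuePairing r Y) fun _ hZ =>
    coeff_zero_trace_mul_left hY (Submodule.mem_comap.1 hZ)

theorem stratum_isRepresentative (hr : 0 ≤ r) (hY : Y ∈ x.gl (-r)) :
    (stratum hr hY).IsRepresentative Y := ⟨hY, fun _ => rfl⟩

end BuildingPoint

namespace Stratum.IsRepresentative

variable {S : Stratum k U} {Y Y' : Module.End k⸨X⸩ U}

theorem sub_mem_glPlus (hY : S.IsRepresentative Y) (hY' : S.IsRepresentative Y') :
    Y - Y' ∈ S.point.glPlus (-S.depth) := by
  refine BuildingPoint.mem_glPlus_of_coeff_zero_trace_mul (sub_mem hY.1 hY'.1) fun Z hZ => ?_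
  rw [sub_mul, map_sub, HahnSeries.coeff_sub, ← hY.2 ⟨Z, hZ⟩, ← hY'.2 ⟨Z, hZ⟩, sub_self]

theorem of_sub_mem (hY : S.IsRepresentative Y) (h : Y - Y' ∈ S.point.glPlus (-S.depth)) :
    S.IsRepresentative Y' := by
  refine ⟨?_, fun Z => ?_⟩
  · simpa only [sub_sub_cancel] using sub_mem hY.1 (BuildingPoint.glPlus_le_gl _ h)
  · rw [hY.2, ← sub_eq_zero, ← HahnSeries.coeff_sub, ← map_sub, ← sub_mul,
      BuildingPoint.coeff_zero_trace_mul_right h Z.2]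

theorem isFundamental_iff (hY : S.IsRepresentative Y) :
    S.IsFundamental ↔ ¬ S.point.HasNilpotentSymbol (-S.depth) (Y.restrictScalars k) := by
  constructor
  · intro hfund hnil
    obtain ⟨b, a, h⟩ := S.point.exists_isAdapted
    exact hfund _ (hY.of_sub_mem (h.sub_leadingTerm_mem hY.1))
      ((h.hasNilpotentSymbol_iff hY.1).1 hnil)
  · intro hsymb Y' hY' hnil
    obtain ⟨N, hN⟩ := hnil
    have hN' : Y'.restrictScalars k ^ N = 0 := LinearMap.ext fun u => by
      rw [Module.End.pow_apply, LinearMap.coe_restrictScalars, ← Module.End.pow_apply, hN]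
      rfl
    exact hsymb ((BuildingPoint.HasNilpotentSymbol.of_isNilpotent ⟨N, hN'⟩).of_sub_mem hY'.1
      (hY'.sub_mem_glPlus hY))

end Stratum.IsRepresentative

namespace Connection

variable [Algebra ℝ k] {D : Connection k U} {S : Stratum k U} {x : BuildingPoint k U} {r : ℝ}

theorem Contains.op_mem_operators (hS : D.Contains S) : D.op ∈ S.point.operators (-S.depth) := by
  obtain ⟨Y, hY, hD⟩ := hS
  intro t u hu
  obtain ⟨s, hs, hsub⟩ := hD t u hu
  have hscalar : algebraMap ℝ k t • u ∈ S.point.filt (t + -S.depth) :=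
    S.point.filt_antitone (by linarith [S.depth_nonneg]) (S.point.smul_mem_filt _ hu)
  have hrest := S.point.filt_antitone (by linarith : t + -S.depth ≤ s) hsub
  simpa only [sub_add_cancel] using add_mem (add_mem hrest (hY.1 t u hu)) hscalar

/- In positive depth the scalar `j` in the definition of containment has higher order. -/
theorem Contains.exists_sub_mem_operatorsPlus (hS : D.Contains S) (hr : 0 < S.depth) :
    ∃ Y, S.IsRepresentative Y ∧
      D.op - Y.restrictScalars k ∈ S.point.operatorsPlus (-S.depth) := by
  obtain ⟨Y, hY, hD⟩ := hS
  obtain ⟨b, a, h⟩ := S.point.exists_isAdapted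
  have hlin : D.linearization b - Y ∈ S.point.glPlus (-S.depth) := by
    refine h.mem_glPlus_iff.2 fun j => ?_
    have hscalar : algebraMap ℝ k (a j) • b j ∈ S.point.filtPlus (a j - S.depth) :=
      ⟨a j, by linarith, S.point.smul_mem_filt _ (h.basis_mem j)⟩
    rw [LinearMap.sub_apply, linearization_basis, ← sub_eq_add_neg]
    simpa only [sub_right_comm, sub_add_cancel] using
      add_mem (hD _ _ (h.basis_mem j)) hscalar
  refine ⟨Y, hY, ?_⟩
  rw [← sub_add_sub_cancel _ ((D.linearization b).restrictScalars k)]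
  exact add_mem (BuildingPoint.operators_le_operatorsPlus (neg_neg_of_pos hr)
    (D.op_sub_linearization_mem h)) hlin

theorem Contains.isFundamental_iff (hS : D.Contains S) (hr : 0 < S.depth) :
    S.IsFundamental ↔ ¬ S.point.HasNilpotentSymbol (-S.depth) D.op := by
  obtain ⟨Y, hY, hsub⟩ := hS.exists_sub_mem_operatorsPlus hr
  rw [hY.isFundamental_iff, not_iff_not]
  refine ⟨fun hnil => hnil.of_sub_mem hY.1 ?_, fun hnil => hnil.of_sub_mem hS.op_mem_operators hsub⟩
  simpa only [neg_sub] using neg_mem hsub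

/-- The `F`-linear endomorphism with `Y b_j = ∇_τ b_j - a_j b_j`: it represents the stratum that `∇`
contains at the point with coordinates `a` in the apartment of `b`. -/
def shiftedLinearization {ι : Type*} (D : Connection k U) (b : Module.Basis ι k⸨X⸩ U) (a : ι → ℝ) :
    Module.End k⸨X⸩ U :=
  b.constr k⸨X⸩ fun j => D.op (b j) - algebraMap ℝ k (a j) • b j

theorem repr_op_sub_shiftedLinearization {ι : Type*} [Finite ι] (D : Connection k U)
    (b : Module.Basis ι k⸨X⸩ U) (a : ι → ℝ) (t : ℝ) (u : U) (j : ι) (m : ℤ) :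
    (b.repr (D.op u - algebraMap ℝ k t • u - D.shiftedLinearization b a u) j).coeff m =
      algebraMap ℝ k (m + a j - t) * (b.repr u j).coeff m := by
  have := Fintype.ofFinite ι
  have hY : D.linearization b u - D.shiftedLinearization b a u =
      ∑ i, (algebraMap ℝ k (a i) • b.repr u i) • b i := by
    conv_lhs => rw [← b.sum_repr u]
    simp only [map_sum, map_smul, linearization_basis, shiftedLinearization, b.constr_basis,
      ← Finset.sum_sub_distrib, ← smul_sub, sub_sub_cancel, smul_assoc, smul_comm (b.repr u _)]
  have hsplit : D.op u - algebraMap ℝ k t • u - D.shiftedLinearization b a u =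
      D.op u - D.linearization b u + (D.linearization b u - D.shiftedLinearization b a u) -
        algebraMap ℝ k t • u := by abel
  have ht : b.repr (algebraMap ℝ k t • u) j = algebraMap ℝ k t • b.repr u j := by
    rw [← C_smul, map_smul, Finsupp.smul_apply, smul_eq_mul, HahnSeries.C_mul_eq_smul]
  rw [hsplit, map_sub, map_add, Finsupp.sub_apply, Finsupp.add_apply, repr_op_sub_linearization,
    hY, b.repr_sum_self, ht, HahnSeries.coeff_sub, HahnSeries.coeff_add, euler_coeff,
    HahnSeries.coeff_smul, HahnSeries.coeff_smul, map_sub, map_add, map_intCast, smul_eq_mul,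
    smul_eq_mul, sub_mul, add_mul]

theorem exists_contains (hD : D.op ∈ x.operators (-r)) (hr : 0 ≤ r) :
    ∃ S : Stratum k U, D.Contains S ∧ S.depth = r := by
  obtain ⟨b, a, h⟩ := x.exists_isAdapted
  have hY : D.shiftedLinearization b a ∈ x.gl (-r) := by
    refine h.mem_gl_iff.2 fun j => ?_
    rw [shiftedLinearization, b.constr_basis]
    exact sub_mem (hD _ _ (h.basis_mem j))
      (x.filt_antitone (by linarith) (x.smul_mem_filt _ (h.basis_mem j)))
  refine ⟨BuildingPoint.stratum hr hY,
    ⟨_, BuildingPoint.stratum_isRepresentative hr hY, fun t u hu => ?_⟩, rfl⟩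
  have hplus : D.op u - algebraMap ℝ k t • u - D.shiftedLinearization b a u ∈ x.filtPlus t := by
    refine h.mem_filtPlus_iff.2 fun j m hm => ?_
    rw [repr_op_sub_shiftedLinearization]
    rcases hm.lt_or_eq with hlt | heq
    · rw [(h t u).1 hu j m (by linarith), mul_zero]
    · rw [add_comm, heq, sub_self, map_zero, zero_mul]
  obtain ⟨s, hs, hmem⟩ := hplus
  exact ⟨s, lt_of_le_of_lt (sub_le_self t hr) hs, hmem⟩

end Connection

end Strata

/-! ### Lattices -/

section Lattices

variable {k : Type u} [Field k]

theorem vanishBelow_ceil_iff {f : k⸨X⸩} {c : ℝ} : VanishBelow f ⌈c⌉ ↔ VanishBelow f c :=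
  forall_congr' fun m => by rw [Int.cast_lt, Int.lt_ceil]

theorem vanishBelow_single_mul_iff {f : k⸨X⸩} {c : ℝ} {m : ℤ} :
    VanishBelow (HahnSeries.single m (1 : k) * f) (c + m) ↔ VanishBelow f c := by
  refine ⟨fun hf l hl => ?_, fun hf => ?_⟩
  · rw [← one_mul (f.coeff l), ← HahnSeries.coeff_single_mul_add]
    exact hf _ (by push_cast; linarith)
  · rw [add_comm]
    exact (VanishBelow.single m 1).mul hf

variable {U : Type v} [AddCommGroup U] [Module k⸨X⸩ U] [Module k⟦X⟧ U]

theorem BuildingPoint.inShiftedLattice_filt_zero_iff {ι : Type*} (x : BuildingPoint k U) (m : ℤ)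
    (e : ι → U) : InShiftedLattice (x.filt 0) m e ↔ ∀ j, e j ∈ x.filt m := by
  refine forall_congr' fun j => ⟨?_, fun h => ?_⟩
  · rintro ⟨w, hw, h⟩
    rw [h, ← zero_add (m : ℝ), x.single_smul_mem_filt]
    exact hw
  · refine ⟨(HahnSeries.single (-m) (1 : k) : k⸨X⸩) • e j, ?_, ?_⟩
    · rwa [← add_neg_cancel (m : ℝ), ← Int.cast_neg, x.single_smul_mem_filt]
    · rw [smul_smul, HahnSeries.single_mul_single, add_neg_cancel, mul_one,
        HahnSeries.single_zero_one, one_smul]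

variable [IsScalarTower k⟦X⟧ k⸨X⸩ U]

theorem isLattice_span_range_basis {R K V ι : Type*} [CommRing R] [CommRing K] [Algebra R K]
    [AddCommGroup V] [Module R V] [Module K V] [IsScalarTower R K V] [Finite ι]
    (b : Module.Basis ι K V) : (Submodule.span R (Set.range b)).IsLattice K where
  fg := Submodule.fg_span (Set.finite_range b)
  span_eq_top := by rw [Submodule.span_span_of_tower, b.span_eq]

theorem exists_span_range_eq_of_isLattice {R K V : Type*} [CommRing R] [IsDomain R]
    [IsPrincipalIdealRing R] [Field K] [Algebra R K] [IsFractionRing R K] [AddCommGroup V]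
    [Module R V] [Module K V] [IsScalarTower R K V] (L : Submodule R V) [L.IsLattice K] :
    ∃ b : Module.Basis (Fin (Module.finrank K V)) K V, L = Submodule.span R (Set.range b) := by
  let b₀ := Module.Free.chooseBasis R L
  let b := b₀.extendOfIsLattice K
  let σ := Fintype.equivFinOfCardEq (Module.finrank_eq_card_basis b).symm
  have hb : ⇑b = L.subtype ∘ b₀ := funext fun i => b₀.extendOfIsLattice_apply K i
  refine ⟨b.reindex σ, ?_⟩
  rw [b.range_reindex, hb, Set.range_comp, ← Submodule.map_span, b₀.span_eq,
    Submodule.map_subtype_top]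

theorem mem_span_range_basis_iff {ι : Type*} (b : Module.Basis ι k⸨X⸩ U) {u : U} :
    u ∈ Submodule.span k⟦X⟧ (Set.range b) ↔ ∀ i, VanishBelow (b.repr u i) 0 := by
  simp only [b.mem_span_iff_repr_mem k⟦X⟧, vanishBelow_zero_iff, Set.mem_range]

namespace BuildingPoint

theorem exists_isAdapted_zero_of_isLattice (L : Submodule k⟦X⟧ U) [L.IsLattice k⸨X⸩] :
    ∃ (x : BuildingPoint k U) (b : Module.Basis (Fin (Module.finrank k⸨X⸩ U)) k⸨X⸩ U),
      x.IsAdapted b 0 ∧ x.filt 0 = L := by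
  obtain ⟨b, rfl⟩ := exists_span_range_eq_of_isLattice L
  refine ⟨ofBasis b 0, b, ofBasis_isAdapted b 0, Submodule.ext fun u => ?_⟩
  simp only [mem_span_range_basis_iff, ofBasis_isAdapted b 0 0 u, Pi.zero_apply, sub_zero]

/- Rescaling each vector of an adapted basis by a power of `z` moves its degree to the first one in
its residue class modulo `1` that is at least `t`. -/
theorem exists_filt_eq_span (x : BuildingPoint k U) (t : ℝ) :
    ∃ b : Module.Basis (Fin (Module.finrank k⸨X⸩ U)) k⸨X⸩ U,
      x.filt t = Submodule.span k⟦X⟧ (Set.range b) := by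
  obtain ⟨b, a, h⟩ := x.exists_isAdapted
  have hw (i) : IsUnit (HahnSeries.single ⌈t - a i⌉ (1 : k) : k⸨X⸩) :=
    (HahnSeries.single_ne_zero one_ne_zero).isUnit
  refine ⟨b.isUnitSMul hw, Submodule.ext fun u => ?_⟩
  rw [mem_span_range_basis_iff, h t u]
  refine forall_congr' fun i => ?_
  have hrepr : b.repr u i =
      HahnSeries.single ⌈t - a i⌉ (1 : k) * (b.isUnitSMul hw).repr u i := by
    rw [b.repr_isUnitSMul, Units.smul_def, smul_eq_mul]
    exact (Units.mul_inv_cancel_left (hw i).unit _).symm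
  rw [hrepr, ← vanishBelow_ceil_iff, ← vanishBelow_single_mul_iff (c := 0), zero_add]

theorem isLattice_filt (x : BuildingPoint k U) (t : ℝ) : (x.filt t).IsLattice k⸨X⸩ := by
  obtain ⟨b, hb⟩ := x.exists_filt_eq_span t
  rw [hb]
  exact isLattice_span_range_basis b

end BuildingPoint

end Lattices

/-! ### Points realizing the slope -/

namespace Connection

variable {k : Type u} [Field k]
variable {U : Type v} [AddCommGroup U] [Module k⸨X⸩ U] [Module k⟦X⟧ U]

variable [IsScalarTower k⟦X⟧ k⸨X⸩ U] [Module k U] [IsScalarTower k k⸨X⸩ U]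

section Valuation

variable {ι : Type*} {x y : BuildingPoint k U}

theorem exists_isGreatest_inShiftedLattice {v : ι → U} {p q : ℝ} (hp : ∀ j, v j ∈ y.filt p)
    (hq : ∃ j, v j ∉ y.filt q) :
    ∃ m, IsGreatest {m : ℤ | InShiftedLattice (y.filt 0) m v} m ∧ p - 1 < m ∧ m < q := by
  simp only [y.inShiftedLattice_filt_zero_iff]
  have hlt {m : ℤ} (hm : ∀ j, v j ∈ y.filt m) : (m : ℝ) < q := by
    obtain ⟨j, hj⟩ := hq
    by_contra! hqm
    exact hj (y.filt_antitone hqm (hm j))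
  have hfloor : ∀ j, v j ∈ y.filt ⌊p⌋ := fun j => y.filt_antitone (Int.floor_le p) (hp j)
  obtain ⟨m, hm, hmax⟩ := Int.exists_greatest_of_bdd
    ⟨⌈q⌉, fun m hm => Int.cast_le.1 ((hlt hm).le.trans (Int.le_ceil q))⟩ ⟨⌊p⌋, hfloor⟩
  exact ⟨m, ⟨hm, hmax⟩,
    (Int.sub_one_lt_floor p).trans_le (Int.cast_le.2 (hmax _ hfloor)), hlt hm⟩

theorem growsAtMost_and_growsAtLeast_iff {D : Connection k U} {e : ι → U} {r : ℝ} :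
    D.GrowsAtMost y e r ∧ D.GrowsAtLeast y e r ↔ ∃ C : ℝ, ∀ i : ℕ, 0 < i → ∃ m : ℤ,
      IsGreatest {m : ℤ | InShiftedLattice (y.filt 0) m fun j => (D.op ^ i) (e j)} m ∧
        |m + r * i| ≤ C := by
  constructor
  · rintro ⟨⟨C, hC⟩, C', hC'⟩
    refine ⟨max (C + 1) C', fun i hi => ?_⟩
    obtain ⟨m, hm, hlow, hupp⟩ := exists_isGreatest_inShiftedLattice (hC i hi) (hC' i hi)
    have := le_max_left (C + 1) C'
    have := le_max_right (C + 1) C'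
    exact ⟨m, hm, abs_le.2 ⟨by linarith, by linarith⟩⟩
  · rintro ⟨C, hC⟩
    simp only [y.inShiftedLattice_filt_zero_iff] at hC
    refine ⟨⟨C, fun i hi j => ?_⟩, C + 1, fun i hi => ?_⟩ <;>
      obtain ⟨m, ⟨hmem, hmax⟩, hm⟩ := hC i hi <;> rw [abs_le] at hm
    · exact y.filt_antitone (by linarith) (hmem j)
    · by_contra! hall
      refine (lt_add_one m).not_ge (hmax fun j => y.filt_antitone ?_ (hall j))
      push_cast
      linarith

end Valuation

theorem isRegularSingular_iff_exists_mem_operators {D : Connection k U} :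
    D.IsRegularSingular ↔ ∃ x : BuildingPoint k U, D.op ∈ x.operators 0 := by
  constructor
  · rintro ⟨L, hL, hDL⟩
    obtain ⟨x, b, h, rfl⟩ := BuildingPoint.exists_isAdapted_zero_of_isLattice L
    refine ⟨x, neg_zero (G := ℝ) ▸ D.op_mem_operators_of_basis h le_rfl fun j => ?_⟩
    rw [Pi.zero_apply, sub_zero]
    exact hDL _ (h.basis_mem j)
  · rintro ⟨x, hD⟩
    exact ⟨x.filt 0, x.isLattice_filt 0, fun u hu => by simpa only [add_zero] using hD 0 u hu⟩

/-- The point `x` realizes the slope `s`: `∇_τ` moves the filtration of `x` down by at most `s`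
steps, and unless `s = 0` its symbol of degree `-s` is not nilpotent. -/
structure IsOptimal (D : Connection k U) (x : BuildingPoint k U) (s : ℝ) : Prop where
  nonneg : 0 ≤ s
  op_mem : D.op ∈ x.operators (-s)
  not_hasNilpotentSymbol : 0 < s → ¬ x.HasNilpotentSymbol (-s) D.op

namespace IsOptimal

variable {D : Connection k U} {x y : BuildingPoint k U} {s r : ℝ}

theorem growsAtLeast {ι : Type*} [Finite ι] (h : D.IsOptimal x s) (hs : 0 < s)
    (y : BuildingPoint k U) (e : Module.Basis ι k⸨X⸩ U) : D.GrowsAtLeast y e s :=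
  growsAtLeast_of_not_hasNilpotentSymbol hs h.op_mem (h.not_hasNilpotentSymbol hs) y e

theorem le (h : D.IsOptimal x s) (hr : 0 ≤ r) (hD : D.op ∈ y.operators (-r)) : s ≤ r := by
  rcases h.nonneg.eq_or_lt with rfl | hs
  · exact hr
  · obtain ⟨e, -⟩ := y.exists_apartment
    exact (h.growsAtLeast hs y e).le (growsAtMost_of_mem hD y e)

theorem eq (h : D.IsOptimal x s) (h' : D.IsOptimal y r) : s = r :=
  (h.le h'.nonneg h'.op_mem).antisymm (h'.le h.nonneg h.op_mem)

theorem of_mem (h : D.IsOptimal x s) (hD : D.op ∈ y.operators (-s)) : D.IsOptimal y s where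
  nonneg := h.nonneg
  op_mem := hD
  not_hasNilpotentSymbol hs hnil := by
    obtain ⟨e, -⟩ := y.exists_apartment
    obtain ⟨r, hrs, hr⟩ := exists_lt_growsAtMost hD hnil y e
    exact hrs.not_ge ((h.growsAtLeast hs y e).le hr)

theorem isRegularSingular_iff (h : D.IsOptimal x s) : D.IsRegularSingular ↔ s = 0 := by
  rw [isRegularSingular_iff_exists_mem_operators]
  constructor
  · rintro ⟨y, hy⟩
    exact (h.le le_rfl (by rwa [neg_zero])).antisymm h.nonneg
  · rintro rfl
    exact ⟨x, neg_zero (G := ℝ) ▸ h.op_mem⟩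

theorem hasSlope_iff {ι : Type*} [Finite ι] {s : ℚ} (h : D.IsOptimal x s)
    (L : Submodule k⟦X⟧ U) [L.IsLattice k⸨X⸩] (e : Module.Basis ι k⸨X⸩ U) (t : ℚ) :
    D.HasSlope L e t ↔ t = s := by
  obtain ⟨y, -, -, rfl⟩ := BuildingPoint.exists_isAdapted_zero_of_isLattice L
  have hbound : (∃ C : ℚ, ∀ i : ℕ, 0 < i → ∃ m : ℤ,
      IsGreatest {m : ℤ | InShiftedLattice (y.filt 0) m fun j => (D.op ^ i) (e j)} m ∧
        |(m : ℚ) + t * i| ≤ C) ↔ D.GrowsAtMost y e t ∧ D.GrowsAtLeast y e t := by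
    rw [growsAtMost_and_growsAtLeast_iff]
    constructor
    · rintro ⟨C, hC⟩
      exact ⟨C, fun i hi => (hC i hi).imp fun m hm => ⟨hm.1, by exact_mod_cast hm.2⟩⟩
    · rintro ⟨C, hC⟩
      obtain ⟨q, hq⟩ := exists_rat_gt C
      exact ⟨q, fun i hi => (hC i hi).imp fun m hm => ⟨hm.1, by exact_mod_cast hm.2.trans hq.le⟩⟩
  rw [HasSlope, hbound, h.isRegularSingular_iff, Rat.cast_eq_zero]
  rcases (Rat.cast_nonneg.1 h.nonneg).eq_or_lt with rfl | hs
  · simp only [true_and, not_true_eq_false, false_and, or_false]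
  have hgrow := h.growsAtLeast (Rat.cast_pos.2 hs) y e
  have hgrow' := growsAtMost_of_mem h.op_mem y e
  constructor
  · rintro (⟨h0, -⟩ | ⟨-, -, ht', ht⟩)
    · exact absurd h0 hs.ne'
    · exact_mod_cast (ht.le hgrow').antisymm (hgrow.le ht')
  · rintro rfl
    exact Or.inr ⟨hs.ne', hs, hgrow', hgrow⟩

end IsOptimal

theorem Contains.isOptimal [Algebra ℝ k] {D : Connection k U} {S : Stratum k U}
    (hS : D.Contains S) (hfund : 0 < S.depth → S.IsFundamental) :
    D.IsOptimal S.point S.depth where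
  nonneg := S.depth_nonneg
  op_mem := hS.op_mem_operators
  not_hasNilpotentSymbol hr := (hS.isFundamental_iff hr).1 (hfund hr)

end Connection

/-! ### Cyclic vectors -/

section

theorem iterate_apply_zero_eq {α : Type*} {m : ℕ} {T : α → α} {e : Fin (m + 1) → α}
    (hT : ∀ i : Fin m, T (e i.castSucc) = e i.succ) (i : Fin (m + 1)) : T^[i] (e 0) = e i := by
  induction i using Fin.induction with
  | zero => rfl
  | succ i ih => rw [Fin.val_succ, Function.iterate_succ_apply', ← Fin.val_castSucc, ih, hT]

theorem apply_last_eq_zero_of_isNilpotent {K V : Type*} [Field K] [AddCommGroup V] [Module K V]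
    {m : ℕ} (b : Module.Basis (Fin (m + 1)) K V) {E : Module.End K V} (hE : IsNilpotent E)
    (hb : ∀ i : Fin m, E (b i.castSucc) = b i.succ) : E (b (Fin.last m)) = 0 := by
  have : FiniteDimensional K V := .of_basis b
  obtain ⟨N, hN⟩ := hE
  have hker := Module.End.ker_pow_le_ker_pow_finrank E N
  rw [Module.finrank_eq_card_basis b, Fintype.card_fin, hN, LinearMap.ker_zero] at hker
  have h0 : (E ^ (m + 1)) (b 0) = 0 := hker Submodule.mem_top
  rw [Module.End.pow_apply, Function.iterate_succ_apply'] at h0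
  rw [← iterate_apply_zero_eq hb (Fin.last m), Fin.val_last, h0]

variable {k : Type u} [Field k]

/- The number `s` is the steepest slope of the Newton polygon with abscissae `w` and ordinates the
orders of the `f i`, or `0` if all slopes are negative. -/
theorem exists_newton_slope {ι : Type*} [Finite ι] (f : ι → k⸨X⸩) {w : ι → ℚ}
    (hw : ∀ i, 0 < w i) :
    ∃ s : ℚ, 0 ≤ s ∧ (∀ i, VanishBelow (f i) (-(s * w i))) ∧
      (0 < s → ∃ i, ∃ n : ℤ, (n : ℝ) = -(s * w i) ∧ (f i).coeff n ≠ 0) := by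
  let slope : Option ι → ℚ := fun o => o.elim 0 fun i => -(f i).order / w i
  obtain ⟨o, ho⟩ := Finite.exists_max slope
  refine ⟨slope o, ho none, fun i n hn => HahnSeries.coeff_eq_zero_of_lt_order ?_, fun hs => ?_⟩
  · have hi : -(f i).order ≤ slope o * w i := (div_le_iff₀ (hw i)).1 (ho (some i))
    have hn' : (n : ℚ) < -(slope o * w i) := by exact_mod_cast hn
    exact_mod_cast hn'.trans_le (neg_le.1 hi)
  · rcases o with _ | i
    · exact absurd hs (lt_irrefl _)
    · have hi : slope (some i) * w i = -(f i).order := div_mul_cancel₀ _ (hw i).ne'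
      refine ⟨i, (f i).order, ?_, fun h => ?_⟩
      · have hi' : ((f i).order : ℚ) = -(slope (some i) * w i) := by rw [hi, neg_neg]
        exact_mod_cast hi'
      · rw [HahnSeries.coeff_order_eq_zero.1 h] at hi
        rw [HahnSeries.order_zero, Int.cast_zero, neg_zero] at hi
        exact (mul_pos hs (hw i)).ne' hi

namespace Connection

variable {U : Type v} [AddCommGroup U] [Module k⸨X⸩ U] [Module k⟦X⟧ U]
  [IsScalarTower k⟦X⟧ k⸨X⸩ U] [Module k U] [IsScalarTower k k⸨X⸩ U]

theorem hasNilpotentSymbol_iff_isNilpotent_leadingTerm {ι : Type*} [Fintype ι]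
    {D : Connection k U} {x : BuildingPoint k U} {b : Module.Basis ι k⸨X⸩ U} {a : ι → ℝ} {r : ℝ}
    (h : x.IsAdapted b a) (hr : 0 < r) (hD : D.op ∈ x.operators (-r)) :
    x.HasNilpotentSymbol (-r) D.op ↔ IsNilpotent (leadingTerm b a (-r) (D.linearization b)) := by
  have hsub := BuildingPoint.operators_le_operatorsPlus (neg_lt_zero.2 hr)
    (D.op_sub_linearization_mem h)
  have hlin : (D.linearization b).restrictScalars k ∈ x.operators (-r) := by
    simpa only [sub_sub_cancel] using
      sub_mem hD (BuildingPoint.operatorsPlus_le_operators _ hsub)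
  rw [← h.hasNilpotentSymbol_iff hlin]
  exact ⟨.of_sub_mem hD hsub, .of_sub_mem hlin (by rw [← neg_sub]; exact neg_mem hsub)⟩

theorem exists_isOptimal_of_cyclic (D : Connection k U) {m : ℕ}
    (b : Module.Basis (Fin (m + 1)) k⸨X⸩ U) (hb : ∀ i : Fin m, D.op (b i.castSucc) = b i.succ) :
    ∃ (x : BuildingPoint k U) (s : ℚ), D.IsOptimal x s := by
  let w : Fin (m + 1) → ℚ := fun i => m + 1 - (i : ℕ)
  have hw (i) : 0 < w i := sub_pos.2 (by exact_mod_cast i.2)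
  obtain ⟨s, hs, hlow, hupp⟩ := exists_newton_slope (b.repr (D.op (b (Fin.last m)))) hw
  let a : Fin (m + 1) → ℝ := fun i => -(s * (i : ℕ))
  have ha (i) : a (Fin.last m) + -s - a i = -(s * w i) := by
    simp only [a, w, Fin.val_last]
    push_cast
    ring
  have ha' (i : Fin m) : a i.castSucc + -s = a i.succ := by
    simp only [a, Fin.val_castSucc, Fin.val_succ]
    push_cast
    ring
  have hx := BuildingPoint.ofBasis_isAdapted b a
  have hD : D.op ∈ (BuildingPoint.ofBasis b a).operators (-s) := by
    refine D.op_mem_operators_of_basis hx (Rat.cast_nonneg.2 hs) fun j => ?_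
    rw [sub_eq_add_neg]
    induction j using Fin.lastCases with
    | cast i => rw [hb, ha']; exact hx.basis_mem _
    | last => exact (hx _ _).2 fun i => by rw [ha]; exact hlow i
  refine ⟨.ofBasis b a, s, Rat.cast_nonneg.2 hs, hD, fun hs0 hnil => ?_⟩
  rw [hasNilpotentSymbol_iff_isNilpotent_leadingTerm hx hs0 hD] at hnil
  have hlast := apply_last_eq_zero_of_isNilpotent b hnil fun i => by
    rw [leadingTerm_basis, linearization_basis, hb, ha',
      (isHomogeneous_basis _).homogeneousPart_eq]
  obtain ⟨i, n, hn, hne⟩ := hupp (Rat.cast_pos.1 hs0)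
  rw [leadingTerm_basis, linearization_basis] at hlast
  rw [← degreePart_coeff_of_eq (hn.trans (ha i).symm), ← repr_homogeneousPart, hlast, map_zero,
    Finsupp.zero_apply, HahnSeries.coeff_zero] at hne
  exact hne rfl

end Connection

end

/-! ### Extensions -/

section

variable {k : Type u} [Field k]

section Transport

variable {U V : Type*} [AddCommGroup U] [Module k⸨X⸩ U] [Module k⟦X⟧ U]
  [IsScalarTower k⟦X⟧ k⸨X⸩ U] [Module k U] [IsScalarTower k k⸨X⸩ U]
  [AddCommGroup V] [Module k⸨X⸩ V] [Module k⟦X⟧ V]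
  [IsScalarTower k⟦X⟧ k⸨X⸩ V] [Module k V] [IsScalarTower k k⸨X⸩ V]
  {x : BuildingPoint k U} {y : BuildingPoint k V} {T : Module.End k U} {S : Module.End k V} {d : ℝ}

namespace BuildingPoint.HasNilpotentSymbol

theorem of_intertwines_embedding (φ : V →ₗ[k] U) (hφ : ∀ r v, φ v ∈ x.filt r ↔ v ∈ y.filt r)
    (h : T ∘ₗ φ = φ ∘ₗ S) (hnil : x.HasNilpotentSymbol d T) : y.HasNilpotentSymbol d S := by
  obtain ⟨N, t, ht, hN⟩ := hnil
  refine ⟨N, t, ht, fun s v hv => (hφ _ _).1 ?_⟩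
  rw [← LinearMap.comp_apply, ← Module.End.commute_pow_left_of_commute h N]
  exact hN s _ ((hφ _ _).2 hv)

theorem of_intertwines_quotient (π : U →ₗ[k] V)
    (hπ : ∀ r v, v ∈ y.filt r ↔ ∃ u ∈ x.filt r, π u = v)
    (h : S ∘ₗ π = π ∘ₗ T) (hnil : x.HasNilpotentSymbol d T) : y.HasNilpotentSymbol d S := by
  obtain ⟨N, t, ht, hN⟩ := hnil
  refine ⟨N, t, ht, fun s v hv => ?_⟩
  obtain ⟨u, hu, rfl⟩ := (hπ _ _).1 hv
  exact (hπ _ _).2 ⟨(T ^ N) u, hN s u hu,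
    (LinearMap.congr_fun (Module.End.commute_pow_left_of_commute h N) u).symm⟩

end BuildingPoint.HasNilpotentSymbol

end Transport

section Subquotient

variable {U : Type v} [AddCommGroup U] [Module k⸨X⸩ U] [Module k U] [IsScalarTower k k⸨X⸩ U]

namespace Connection

variable (D : Connection k U) (V : Submodule k⸨X⸩ U) (hV : ∀ u ∈ V, D.op u ∈ V)

/-- The subconnection of `D` on a `∇_τ`-stable subspace. -/
def restrict : Connection k V where
  op := D.op.restrict (p := V.restrictScalars k) (q := V.restrictScalars k) hV
  leibniz f v := Subtype.ext (D.leibniz f v)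

/-- The quotient connection of `D` by a `∇_τ`-stable subspace. -/
def quotient : Connection k (U ⧸ V) where
  op := (V.restrictScalars k).mapQ (V.restrictScalars k) D.op hV
  leibniz f := Submodule.Quotient.mk_surjective V |>.forall.2 fun u =>
    congrArg V.mkQ (D.leibniz f u)

variable {D V hV}

theorem mkQ_op (u : U) : V.mkQ (D.op u) = (D.quotient V hV).op (V.mkQ u) := rfl

end Connection

end Subquotient

variable {U : Type v} [AddCommGroup U] [Module k⸨X⸩ U] [Module k⟦X⟧ U]

section Shift

/-- The point `x` with its filtration renumbered by the constant `c`. -/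
def BuildingPoint.shift (x : BuildingPoint k U) (c : ℝ) : BuildingPoint k U where
  filt r := x.filt (r + c)
  exists_apartment := by
    obtain ⟨b, a, h⟩ := x.exists_apartment
    refine ⟨b, fun i => a i - c, fun r u => (h _ _).trans ?_⟩
    exact forall_congr' fun i => forall_congr' fun m => by
      rw [sub_add_eq_add_sub, sub_lt_iff_lt_add]

theorem BuildingPoint.IsAdapted.shift {ι : Type*} {x : BuildingPoint k U}
    {b : Module.Basis ι k⸨X⸩ U} {a : ι → ℝ} (h : x.IsAdapted b a) (c : ℝ) :
    (x.shift c).IsAdapted b fun i => a i - c := fun r u => (h (r + c) u).trans <| by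
  simp only [sub_sub_eq_add_sub, add_sub_right_comm]

variable [IsScalarTower k⟦X⟧ k⸨X⸩ U] [Module k U] [IsScalarTower k k⸨X⸩ U]

theorem Connection.IsOptimal.shift {D : Connection k U} {x : BuildingPoint k U} {s : ℝ}
    (h : D.IsOptimal x s) (c : ℝ) : D.IsOptimal (x.shift c) s :=
  h.of_mem fun r u hu => by
    have := h.op_mem (r + c) u hu
    rwa [add_right_comm] at this

end Shift

section Extension

variable [IsScalarTower k⟦X⟧ k⸨X⸩ U] {V : Submodule k⸨X⸩ U} {m n : Type*} [Fintype m] [Fintype n]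

namespace BuildingPoint

/-- A point of the building of `U` that induces the point with coordinates `a'` on a subspace `V`
and the point with coordinates `a''` on `U ⧸ V`. -/
def extension (b' : Module.Basis m k⸨X⸩ V) (a' : m → ℝ) (b'' : Module.Basis n k⸨X⸩ (U ⧸ V))
    (a'' : n → ℝ) : BuildingPoint k U :=
  ofBasis (b'.sumQuot b'') (Sum.elim a' a'')

variable {x' : BuildingPoint k V} {b' : Module.Basis m k⸨X⸩ V} {a' : m → ℝ}
variable {x'' : BuildingPoint k (U ⧸ V)} {b'' : Module.Basis n k⸨X⸩ (U ⧸ V)} {a'' : n → ℝ}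

theorem mem_filt_extension_iff (h'' : x''.IsAdapted b'' a'') {r : ℝ} {u : U} :
    u ∈ (extension b' a' b'' a'').filt r ↔
      (∀ i, VanishBelow ((b'.sumQuot b'').repr u (.inl i)) (r - a' i)) ∧ V.mkQ u ∈ x''.filt r := by
  rw [extension, ofBasis_isAdapted _ _ r u, Sum.forall, h'' r]
  simp only [Module.Basis.sumQuot_repr_inr, Sum.elim_inl, Sum.elim_inr]

theorem coe_mem_filt_extension_iff (h' : x'.IsAdapted b' a') (h'' : x''.IsAdapted b'' a'') (r : ℝ)
    (v : V) : (v : U) ∈ (extension b' a' b'' a'').filt r ↔ v ∈ x'.filt r := by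
  rw [mem_filt_extension_iff h'', h' r v, V.mkQ_apply, (Submodule.Quotient.mk_eq_zero V).2 v.2]
  simp only [Module.Basis.sumQuot_repr_inl, zero_mem, and_true]

theorem mem_filt_iff_exists_mem_filt_extension (h'' : x''.IsAdapted b'' a'') (r : ℝ) (w : U ⧸ V) :
    w ∈ x''.filt r ↔ ∃ u ∈ (extension b' a' b'' a'').filt r, V.mkQ u = w := by
  refine ⟨fun hw => ?_, ?_⟩
  · obtain ⟨u, rfl⟩ := V.mkQ_surjective w
    let v : V := b'.equivFun.symm fun i => (b'.sumQuot b'').repr u (.inl i)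
    have hv : V.mkQ (u - v) = V.mkQ u := by simp
    refine ⟨u - v, (mem_filt_extension_iff h'').2 ⟨fun i => ?_, hv ▸ hw⟩, hv⟩
    rw [map_sub, Finsupp.sub_apply, Module.Basis.sumQuot_repr_inl, ← b'.equivFun_apply,
      LinearEquiv.apply_symm_apply, sub_self]
    exact VanishBelow.zero _
  · rintro ⟨u, hu, rfl⟩
    exact ((mem_filt_extension_iff h'').1 hu).2

end BuildingPoint

namespace Connection

variable [Module k U] [IsScalarTower k k⸨X⸩ U]
variable {D : Connection k U} {hV : ∀ u ∈ V, D.op u ∈ V} {s s' s'' : ℝ}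
variable {x' : BuildingPoint k V} {b' : Module.Basis m k⸨X⸩ V} {a' : m → ℝ}
variable {x'' : BuildingPoint k (U ⧸ V)} {b'' : Module.Basis n k⸨X⸩ (U ⧸ V)} {a'' : n → ℝ}

/- The component of `∇_τ` from a complement of `V` to `V` is harmless once the complement is placed
far down the filtration. -/
theorem exists_op_mem_operators_extension (h' : x'.IsAdapted b' a') (h'' : x''.IsAdapted b'' a'')
    (hs : 0 ≤ s) (hD' : (D.restrict V hV).op ∈ x'.operators (-s))
    (hD'' : (D.quotient V hV).op ∈ x''.operators (-s)) :
    ∃ c, D.op ∈ (BuildingPoint.extension b' a' b'' fun j => a'' j - c).operators (-s) := by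
  choose p hp using fun (j : n) (i : m) =>
    VanishBelow.exists_of ((b'.sumQuot b'').repr (D.op (b'.sumQuot b'' (.inr j))) (.inl i))
  obtain ⟨c, hc⟩ := Finite.exists_le fun q : n × m => a'' q.1 - s - a' q.2 - p q.1 q.2
  refine ⟨c, D.op_mem_operators_of_basis (BuildingPoint.ofBasis_isAdapted _ _) hs ?_⟩
  rintro (i | j)
  · rw [Module.Basis.sumQuot_inl]
    exact (BuildingPoint.coe_mem_filt_extension_iff h' (h''.shift c) _ _).2
      (hD' _ _ (h'.basis_mem i))
  · refine (BuildingPoint.mem_filt_extension_iff (h''.shift c)).2 ⟨fun i => (hp j i).mono ?_, ?_⟩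
    · rw [Sum.elim_inr]
      linarith [hc (j, i)]
    · rw [mkQ_op (hV := hV), V.mkQ_apply, Module.Basis.sumQuot_inr, sub_eq_add_neg]
      change (D.quotient V hV).op (b'' j) ∈ x''.filt (a'' j - c + -s + c)
      rw [add_right_comm, sub_add_cancel]
      exact hD'' _ _ (h''.basis_mem j)

theorem IsOptimal.exists_extension (h' : (D.restrict V hV).IsOptimal x' s')
    (h'' : (D.quotient V hV).IsOptimal x'' s'') :
    ∃ x : BuildingPoint k U, D.IsOptimal x (max s' s'') := by
  have hs : 0 ≤ max s' s'' := h'.nonneg.trans (le_max_left _ _)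
  obtain ⟨b', a', ha'⟩ := x'.exists_isAdapted
  obtain ⟨b'', a'', ha''⟩ := x''.exists_isAdapted
  obtain ⟨c, hc⟩ := exists_op_mem_operators_extension ha' ha'' hs
    (BuildingPoint.operators_antitone (neg_le_neg (le_max_left s' s'')) h'.op_mem)
    (BuildingPoint.operators_antitone (neg_le_neg (le_max_right s' s'')) h''.op_mem)
  refine ⟨_, hs, hc, fun hpos hnil => ?_⟩
  rcases max_choice s' s'' with hmax | hmax <;> rw [hmax] at hpos hnil
  · refine h'.not_hasNilpotentSymbol hpos (hnil.of_intertwines_embedding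
      (V.restrictScalars k).subtype ?_ rfl)
    exact BuildingPoint.coe_mem_filt_extension_iff ha' (ha''.shift c)
  · refine (h''.shift c).not_hasNilpotentSymbol hpos (hnil.of_intertwines_quotient
      (V.mkQ.restrictScalars k) ?_ rfl)
    exact BuildingPoint.mem_filt_iff_exists_mem_filt_extension (ha''.shift c)

end Connection

end Extension

end

/-! ### Existence of a point realizing the slope -/

theorem exists_linearIndependent_and_succ_mem_span {K V : Type*} [DivisionRing K]
    [AddCommGroup V] [Module K V] [FiniteDimensional K V] (v : ℕ → V) (h0 : v 0 ≠ 0) :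
    ∃ m, LinearIndependent K (fun i : Fin (m + 1) => v i) ∧
      v (m + 1) ∈ Submodule.span K (Set.range fun i : Fin (m + 1) => v i) := by
  by_contra! hstep
  have hind (m : ℕ) : LinearIndependent K fun i : Fin (m + 1) => v i := by
    induction m with
    | zero => exact LinearIndependent.of_subsingleton (ι := Fin 1) 0 h0
    | succ m ih =>
      convert linearIndependent_finSnoc.2 ⟨ih, hstep m ih⟩ using 1
      funext i
      induction i using Fin.lastCases with
      | cast i => rw [Fin.snoc_castSucc, Fin.val_castSucc]
      | last => rw [Fin.snoc_last, Fin.val_last]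
  have hcard := (hind (Module.finrank K V)).fintype_card_le_finrank
  rw [Fintype.card_fin] at hcard
  omega

namespace Connection

variable {k : Type u} [Field k]

section Krylov

variable {U : Type v} [AddCommGroup U] [Module k⸨X⸩ U] [Module k U]

theorem op_mem_span (D : Connection k U) {s : Set U} (hs : ∀ u ∈ s, D.op u ∈ Submodule.span k⸨X⸩ s)
    {u : U} (hu : u ∈ Submodule.span k⸨X⸩ s) : D.op u ∈ Submodule.span k⸨X⸩ s := by
  induction hu using Submodule.span_induction with
  | mem u hu => exact hs u hu
  | zero => rw [map_zero]; exact zero_mem _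
  | add u w _ _ hu hw => rw [map_add]; exact add_mem hu hw
  | smul f u hu ih =>
    rw [D.leibniz]
    exact add_mem (Submodule.smul_mem _ _ hu) (Submodule.smul_mem _ _ ih)

variable [IsScalarTower k k⸨X⸩ U]

theorem exists_cyclic_restrict [FiniteDimensional k⸨X⸩ U] [Nontrivial U] (D : Connection k U) :
    ∃ (V : Submodule k⸨X⸩ U) (hV : ∀ u ∈ V, D.op u ∈ V) (m : ℕ)
      (b : Module.Basis (Fin (m + 1)) k⸨X⸩ V),
      V ≠ ⊥ ∧ ∀ i : Fin m, (D.restrict V hV).op (b i.castSucc) = b i.succ := by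
  obtain ⟨e, he⟩ := exists_ne (0 : U)
  let v : ℕ → U := fun i => (D.op ^ i) e
  have hv (i : ℕ) : D.op (v i) = v (i + 1) := by
    simp only [v, pow_succ', Module.End.mul_apply]
  obtain ⟨m, hli, hmem⟩ := exists_linearIndependent_and_succ_mem_span (K := k⸨X⸩) v he
  refine ⟨_, fun u => D.op_mem_span (Set.forall_mem_range.2 fun i => ?_), m,
    Module.Basis.span hli, fun h => ?_, fun i => Subtype.ext ?_⟩
  · rw [hv]
    rcases i.is_le.eq_or_lt with hi | hi
    · rwa [hi]
    · exact Submodule.subset_span ⟨⟨i + 1, Nat.succ_lt_succ hi⟩, rfl⟩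
  · exact he ((Submodule.mem_bot k⸨X⸩).1 (h ▸ Submodule.subset_span ⟨0, rfl⟩))
  · rw [Module.Basis.span_apply, Module.Basis.span_apply]
    exact hv i

end Krylov

theorem exists_isOptimal {U : Type v} [AddCommGroup U] [Module k⸨X⸩ U] [FiniteDimensional k⸨X⸩ U]
    [Module k⟦X⟧ U] [IsScalarTower k⟦X⟧ k⸨X⸩ U] [Module k U] [IsScalarTower k k⸨X⸩ U]
    (D : Connection k U) : ∃ (x : BuildingPoint k U) (s : ℚ), D.IsOptimal x s := by
  rcases subsingleton_or_nontrivial U with hU | hU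
  · refine ⟨.ofBasis (Module.finBasis k⸨X⸩ U) 0, 0, Rat.cast_nonneg.2 le_rfl, fun s u _ => ?_,
      fun h => absurd (Rat.cast_pos.1 h) (lt_irrefl 0)⟩
    rw [Subsingleton.elim (D.op u) 0]
    exact zero_mem _
  · obtain ⟨V, hV, m, b, hne, hb⟩ := D.exists_cyclic_restrict
    have : Module.finrank k⸨X⸩ (U ⧸ V) < Module.finrank k⸨X⸩ U := by
      have := Submodule.finrank_quotient_add_finrank V
      have := Submodule.one_le_finrank_iff.2 hne
      omega
    obtain ⟨x', s', h'⟩ := (D.restrict V hV).exists_isOptimal_of_cyclic b hb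
    obtain ⟨x'', s'', h''⟩ := (D.quotient V hV).exists_isOptimal
    obtain ⟨x, hx⟩ := h'.exists_extension h''
    exact ⟨x, max s' s'', by rwa [Rat.cast_max]⟩
termination_by Module.finrank k⸨X⸩ U

end Connection

end FormalConnection

end

theorem mainTheorem5_general {k : Type u} [Field k] [Algebra ℝ k]
    {U : Type v} [AddCommGroup U] [Module k⸨X⸩ U] [FiniteDimensional k⸨X⸩ U]
    [Module k⟦X⟧ U] [IsScalarTower k⟦X⟧ k⸨X⸩ U] [Module k U] [IsScalarTower k k⸨X⸩ U]
    (D : FormalConnection.Connection k U) :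
    ∃ s : ℚ,
      (∀ L : Submodule k⟦X⟧ U, L.IsLattice k⸨X⸩ →
        ∀ e : Module.Basis (Fin (Module.finrank k⸨X⸩ U)) k⸨X⸩ U,
        ∀ t : ℚ, D.HasSlope L e t ↔ t = s) ∧
      IsLeast {r : ℝ | ∃ S : FormalConnection.Stratum k U, D.Contains S ∧ S.depth = r} (s : ℝ) ∧
      (∀ S : FormalConnection.Stratum k U, D.Contains S → S.IsFundamental → S.depth = (s : ℝ)) ∧
      (∀ S : FormalConnection.Stratum k U, D.Contains S → 0 < S.depth → S.depth = (s : ℝ) →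
        S.IsFundamental) ∧
      (D.IsRegularSingular ↔ ∃ S : FormalConnection.Stratum k U, D.Contains S ∧ S.depth = 0) := by
  obtain ⟨x, s, hx⟩ := D.exists_isOptimal
  have hleast : IsLeast {r : ℝ | ∃ S : FormalConnection.Stratum k U, D.Contains S ∧ S.depth = r}
      (s : ℝ) := by
    refine ⟨FormalConnection.Connection.exists_contains hx.op_mem hx.nonneg, ?_⟩
    rintro r ⟨S, hS, rfl⟩
    exact hx.le S.depth_nonneg hS.op_mem_operators
  refine ⟨s, fun L hL e t => hx.hasSlope_iff L e t, hleast, fun S hS hfund => ?_,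
    fun S hS hpos hdepth => ?_, ?_⟩
  · exact (hS.isOptimal fun _ => hfund).eq hx
  · have hS' : D.IsOptimal S.point S.depth :=
      hdepth.symm ▸ hx.of_mem (hdepth ▸ hS.op_mem_operators)
    exact (hS.isFundamental_iff hpos).2 (hS'.not_hasNilpotentSymbol hpos)
  · rw [hx.isRegularSingular_iff]
    refine ⟨fun hs => hs ▸ hleast.1, fun h0 => ?_⟩
    exact (hleast.2 h0).antisymm hx.nonneg

theorem mainTheorem5 {k : Type u} [Field k] [IsAlgClosed k] [Algebra ℝ k]
    {U : Type v} [AddCommGroup U] [Module k⸨X⸩ U] [FiniteDimensional k⸨X⸩ U]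
    [Module k⟦X⟧ U] [IsScalarTower k⟦X⟧ k⸨X⸩ U] [Module k U] [IsScalarTower k k⸨X⸩ U]
    (D : FormalConnection.Connection k U) :
    ∃ s : ℚ,
      (∀ L : Submodule k⟦X⟧ U, L.IsLattice k⸨X⸩ →
        ∀ e : Module.Basis (Fin (Module.finrank k⸨X⸩ U)) k⸨X⸩ U,
        ∀ t : ℚ, D.HasSlope L e t ↔ t = s) ∧
      IsLeast {r : ℝ | ∃ S : FormalConnection.Stratum k U, D.Contains S ∧ S.depth = r} (s : ℝ) ∧
      (∀ S : FormalConnection.Stratum k U, D.Contains S → S.IsFundamental → S.depth = (s : ℝ)) ∧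
      (∀ S : FormalConnection.Stratum k U, D.Contains S → 0 < S.depth → S.depth = (s : ℝ) →
        S.IsFundamental) ∧
      (D.IsRegularSingular ↔ ∃ S : FormalConnection.Stratum k U, D.Contains S ∧ S.depth = 0) :=
  mainTheorem5_general D
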